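/- **Theorem.** An odd Durfee symbol of $n$ consists of an integer $D\ge 0$ and two finite, possibly empty, non-increasing sequences $a_1\ge\cdots\ge a_s$ and $b_1\ge\cdots\ge b_t$ of positive odd integers, all of them at most $2D+1$, such that $n=\sum_i a_i+\sum_j b_j+2D^2+2D+1$; its odd rank is $s-t$. Let $N^0(a,M;n)$ be the number of odd Durfee symbols of $n$ whose odd rank is congruent to $a$ modulo $M$. Write $(a;q)_n=\prod_{k=0}^{n-1}(1-aq^k)$, $(a;q)_\infty=\prod_{k=0}^{\infty}(1-aq^k)$, $J_m=(q^m;q^m)_\infty$ and $$g(x;q)=x^{-1}\left(-1+\sum_{n=0}^{\infty}\frac{q^{n^2}}{(x;q)_{n+1}(q/x;q)_{n}}\right).$$ Then for every complex number $q$ with $0<|q|<1$ the following series converge and \begin{align*} &\sum_{n=0}^{\infty}N^{0}(0,2;2n+1)q^n=-qg(-q^2;q^4)+\frac{J_{2}^8J_{8}^2}{J_{1}^4J_{4}^5},\\ &\sum_{n=0}^{\infty}N^{0}(0,2;4n+1)q^n=\frac{J_{2}^9}{J_{1}^6J_{4}^2},\\ &\sum_{n=0}^{\infty}N^{0}(0,2;4n+3)q^n=-g(-q;q^2)+4\frac{J_{4}^6}{J_{1}^2J_{2}^3},\\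 &\sum_{n=0}^{\infty}N^{0}(1,2;2n)q^n=-1+g(-1;q^4)+\frac{1}{2}\frac{J_{2}^6J_{4}}{J_{1}^4J_{8}^2},\\ &\sum_{n=0}^{\infty}N^{0}(1,2;4n)q^n=-1+g(-1;q^2)+\frac{1}{2}\frac{J_{2}^{15}}{J_{1}^8J_{4}^6},\\ &\sum_{n=0}^{\infty}N^{0}(1,2;4n+2)q^n=2\frac{J_{2}^3J_{4}^2}{J_{1}^4},\\ &\sum_{n=0}^{\infty}N^{0}(0,2;8n+1)q^n=\frac{J_{2}^{12}J_{4}}{J_{1}^{10}J_{8}^2}+8q\frac{J_{2}^2J_{4}^3J_{8}^2}{J_{1}^6},\\ &\sum_{n=0}^{\infty}N^{0}(0,2;8n+3)q^n=qg(-q^2;q^4)-\frac{J_{2}^8J_{8}^2}{J_{1}^4J_{4}^5}+4\frac{J_{2}^6J_{4}^5}{J_{1}^8J_{8}^2},\\ &\sum_{n=0}^{\infty}N^{0}(0,2;8n+5)q^n=2\left(\frac{J_{2}^{14}J_{8}^2}{J_{1}^{10}J_{4}^5}+2\frac{J_{4}^9}{J_{1}^6J_{8}^2}\right),\\ &\sum_{n=0}^{\infty}N^{0}(0,2;8n+7)q^n=-q^{-1}+q^{-1}g(-1;q^4)+\frac{1}{2}q^{-1}\frac{J_{2}^6J_{4}}{J_{1}^4J_{8}^2}+8\frac{J_{2}^8J_{8}^2}{J_{1}^8J_{4}},\\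 &\sum_{n=0}^{\infty}N^{0}(1,2;8n)q^n=-1+g(-1;q)+\frac{1}{2}\frac{J_{2}^{22}}{J_{1}^{13}J_{4}^8}+8q\frac{J_{4}^8}{J_{1}^5J_{2}^2},\\ &\sum_{n=0}^{\infty}N^{0}(1,2;8n+2)q^n=2\frac{J_{2}^{16}}{J_{1}^{11}J_{4}^4},\\ &\sum_{n=0}^{\infty}N^{0}(1,2;8n+4)q^n=4\frac{J_{2}^{10}}{J_{1}^9},\\ &\sum_{n=0}^{\infty}N^{0}(1,2;8n+6)q^n=8\frac{J_{2}^4J_{4}^4}{J_{1}^7}. \end{align*} -/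

import Mathlib

/-- An odd Durfee symbol: two non-increasing (possibly empty) rows of positive odd numbers, all of
them at most `2 * D + 1`, with a subscript `D ≥ 0`. -/
@[ext]
structure OddDurfeeSymbol where
  /-- the top row `a₁ ≥ a₂ ≥ ⋯ ≥ aₛ` -/
  top : List ℕ
  /-- the bottom row `b₁ ≥ b₂ ≥ ⋯ ≥ bₜ` -/
  bottom : List ℕ
  /-- the subscript `D` -/
  D : ℕ
  top_sorted : top.Pairwise (fun x y => y ≤ x)
  bottom_sorted : bottom.Pairwise (fun x y => y ≤ x)
  top_odd : ∀ x ∈ top, Odd x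
  bottom_odd : ∀ x ∈ bottom, Odd x
  top_le : ∀ x ∈ top, x ≤ 2 * D + 1
  bottom_le : ∀ x ∈ bottom, x ≤ 2 * D + 1

namespace OddDurfeeSymbol

/-- The number `n` of which `S` is an odd Durfee symbol. -/
def weight (S : OddDurfeeSymbol) : ℕ :=
  S.top.sum + S.bottom.sum + 2 * S.D ^ 2 + 2 * S.D + 1

/-- The odd rank: number of top entries minus number of bottom entries. -/
def oddRank (S : OddDurfeeSymbol) : ℤ :=
  (S.top.length : ℤ) - (S.bottom.length : ℤ)

/-- There are finitely many lists of positive integers with a bounded sum. -/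
theorem finite_lists (n : ℕ) : {l : List ℕ | (∀ x ∈ l, 0 < x) ∧ l.sum ≤ n}.Finite := by
  refine ((List.finite_length_le (Fin (n + 1)) n).image (List.map Fin.val)).subset ?_
  rintro l ⟨hpos, hsum⟩
  have hlt : ∀ x ∈ l, x < n + 1 := fun x hx => by
    have := List.single_le_sum (fun _ _ => Nat.zero_le _) x hx
    omega
  refine ⟨l.pmap (fun x hx => ⟨x, hx⟩) hlt, ?_, ?_⟩
  · have := List.length_le_sum_of_one_le l hpos
    simp only [Set.mem_ofPred_eq, List.length_pmap]
    omega
  · simp [List.map_pmap]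

/-- There are only finitely many odd Durfee symbols of `n`, so that counting them by `Set.ncard`
is meaningful. -/
theorem finite_weight (n : ℕ) : {S : OddDurfeeSymbol | S.weight = n}.Finite := by
  have hinj : Set.InjOn (fun S : OddDurfeeSymbol => (S.top, S.bottom, S.D))
      {S : OddDurfeeSymbol | S.weight = n} := by
    intro S _ T _ h
    simp only [Prod.mk.injEq] at h
    exact OddDurfeeSymbol.ext h.1 h.2.1 h.2.2
  refine Set.Finite.of_finite_image ?_ hinj
  refine ((finite_lists n).prod ((finite_lists n).prod (Set.finite_Iic n))).subset ?_
  rintro _ ⟨S, hS, rfl⟩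
  simp only [Set.mem_ofPred_eq, weight] at hS
  refine ⟨⟨fun x hx => (S.top_odd x hx).pos, ?_⟩, ⟨fun x hx => (S.bottom_odd x hx).pos, ?_⟩, ?_⟩
  · dsimp only; omega
  · dsimp only; omega
  · simp only [Set.mem_Iic]; omega

end OddDurfeeSymbol

/-- `N⁰(a, M; n)`: the number of odd Durfee symbols of `n` with odd rank congruent to `a`
modulo `M`. -/
noncomputable def oddRankCount (a : ℤ) (M n : ℕ) : ℕ :=
  {S : OddDurfeeSymbol | S.weight = n ∧ S.oddRank ≡ a [ZMOD (M : ℤ)]}.ncard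

/-- `(a; q)_n`. -/
noncomputable def qPoch (a q : ℂ) (n : ℕ) : ℂ :=
  ∏ k ∈ Finset.range n, (1 - a * q ^ k)

/-- `(a; q)_∞`. -/
noncomputable def qPochInf (a q : ℂ) : ℂ :=
  ∏' k : ℕ, (1 - a * q ^ k)

/-- `J_m = (q^m; q^m)_∞`, evaluated at `q`. -/
noncomputable def etaJ (q : ℂ) (m : ℕ) : ℂ :=
  qPochInf (q ^ m) (q ^ m)

/-- The universal mock theta function `g(x; q)`. -/
noncomputable def mockG (x q : ℂ) : ℂ :=
  x⁻¹ * (-1 + ∑' n : ℕ, q ^ (n ^ 2) / (qPoch x q (n + 1) * qPoch (q / x) q n))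

open Filter Topology

/-! ### Infinite products -/

/-! All parts of an odd Durfee symbol are odd, so n has the parity of s + t + 1 and the odd rank is
even exactly when n is odd (`OddDurfeeSymbol.even_oddRank_iff`). Hence every series in the theorem
counts all symbols of n in a residue class, and the full generating function is q g(q; q²): the
subscript D contributes q^(2D²+2D+1) / (q; q²)_{D+1}², which is q times a term of the second form of
g (`hasSum_mockG`). It remains to split q g(q; q²) modulo 2, 4 and 8.

The first split rests on Watson's relation (`watson_relation`), q g(q; q²) + 1 - g(-1; q⁸) + q³
g(-q⁴; q⁸) = J₂ J₄⁶ / (2 J₁² J₈⁴). Its second and third terms are even in q and the fourth is odd,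
so only 1 / J₁² has to be split. Up to a function of q² it is φ(q) = ∑ q^(k²), and φ(q) = φ(q⁴) + 2q
ψ(q⁸). The later splits also use 1 / J₁⁴, that is φ(q)² = φ(q²)² + 4q ψ(q⁴)².

Watson's relation comes from partial fractions. The reciprocal of a theta function is a sum of
simple fractions (`hasSum_inv_theta`), the limit of a finite expansion obtained from the finite
triple product. Inserting the finite expansions into the series of g and summing with Cauchy's
identity gives Lambert series for g (`exists_lambert`). On the other side, two expansions of
reciprocal thetas, to bases q² and q⁴, are multiplied and each product of fractions is decomposed.
The inner sums are again reciprocal thetas, and quasi-periodicity turns the outer sums into the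
Lambert series of the three values of g (`watson_sum`). -/

theorem summable_norm_mul_pow (a : ℂ) {q : ℂ} (hq : ‖q‖ < 1) :
    Summable fun k : ℕ => ‖a * q ^ k‖ := by
  simp only [norm_mul, norm_pow]
  exact (summable_geometric_of_lt_one (norm_nonneg _) hq).mul_left _

theorem multipliable_qPochInf (a : ℂ) {q : ℂ} (hq : ‖q‖ < 1) :
    Multipliable fun k : ℕ => 1 - a * q ^ k := by
  simpa [sub_eq_add_neg] using multipliable_one_add_of_summable
    (f := fun k : ℕ => -(a * q ^ k)) (by simpa using summable_norm_mul_pow a hq)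

theorem tendsto_qPoch (a : ℂ) {q : ℂ} (hq : ‖q‖ < 1) :
    Tendsto (qPoch a q) atTop (𝓝 (qPochInf a q)) :=
  (multipliable_qPochInf a hq).tendsto_prod_tprod_nat

theorem qPochInf_ne_zero {a q : ℂ} (hq : ‖q‖ < 1) (h : ∀ k : ℕ, a * q ^ k ≠ 1) :
    qPochInf a q ≠ 0 := by
  have := tprod_one_add_ne_zero_of_summable (f := fun k : ℕ => -(a * q ^ k))
    (fun k => by
      rw [← sub_eq_add_neg]
      exact sub_ne_zero.2 (h k).symm) (by simpa using summable_norm_mul_pow a hq)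
  simpa [sub_eq_add_neg, qPochInf] using this

theorem qPochInf_ne_zero_of_norm_lt {a q : ℂ} (hq : ‖q‖ < 1) (ha : ‖a‖ < 1) :
    qPochInf a q ≠ 0 := by
  refine qPochInf_ne_zero hq fun k h => ?_
  have h1 : ‖a * q ^ k‖ < 1 := by
    rw [norm_mul, norm_pow]
    exact mul_lt_one_of_nonneg_of_lt_one_left (norm_nonneg _) ha
      (pow_le_one₀ (norm_nonneg _) hq.le)
  rw [h] at h1
  simp at h1

theorem qPochInf_shift (a : ℂ) {q : ℂ} (hq : ‖q‖ < 1) :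
    qPochInf a q = (1 - a) * qPochInf (a * q) q := by
  refine tendsto_nhds_unique ((tendsto_qPoch a hq).comp (tendsto_add_atTop_nat 1)) ?_
  refine ((tendsto_qPoch (a * q) hq).const_mul (1 - a)).congr fun n => ?_
  simp only [Function.comp_apply, qPoch, Finset.prod_range_succ', pow_zero, mul_one]
  rw [mul_comm]
  congr 1
  exact Finset.prod_congr rfl fun k _ => by ring

theorem qPochInf_mul_neg (a : ℂ) {q : ℂ} (hq : ‖q‖ < 1) :
    qPochInf a q * qPochInf (-a) q = qPochInf (a ^ 2) (q ^ 2) := by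
  rw [qPochInf, qPochInf, qPochInf,
    ← (multipliable_qPochInf a hq).tprod_mul (multipliable_qPochInf (-a) hq)]
  exact tprod_congr fun k => by ring

theorem norm_pow_lt_one {q : ℂ} (hq : ‖q‖ < 1) {m : ℕ} (hm : m ≠ 0) : ‖q ^ m‖ < 1 := by
  rw [norm_pow]
  exact pow_lt_one₀ (norm_nonneg _) hq hm

theorem qPochInf_even_odd (a : ℂ) {q : ℂ} (hq : ‖q‖ < 1) :
    qPochInf a q = qPochInf a (q ^ 2) * qPochInf (a * q) (q ^ 2) := by
  have h2 := norm_pow_lt_one hq two_ne_zero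
  rw [qPochInf, qPochInf, qPochInf, ← tprod_even_mul_odd]
  · congr 1
    · exact tprod_congr fun k => by rw [pow_mul]
    · exact tprod_congr fun k => by ring
  · exact (multipliable_qPochInf a h2).congr fun k => by rw [pow_mul]
  · exact (multipliable_qPochInf (a * q) h2).congr fun k => by ring

/-- Euler's function `(q; q)_∞`. -/
noncomputable def eulerFn (q : ℂ) : ℂ := qPochInf q q

theorem etaJ_eq (q : ℂ) (m : ℕ) : etaJ q m = eulerFn (q ^ m) := rfl

theorem eulerFn_ne_zero {q : ℂ} (hq : ‖q‖ < 1) : eulerFn q ≠ 0 :=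
  qPochInf_ne_zero_of_norm_lt hq hq

theorem qPochInf_odd_mul {q : ℂ} (hq : ‖q‖ < 1) :
    qPochInf q (q ^ 2) * eulerFn (q ^ 2) = eulerFn q := by
  rw [eulerFn, eulerFn, qPochInf_even_odd q hq, pow_two q]

theorem qPochInf_neg_mul {q : ℂ} (hq : ‖q‖ < 1) :
    qPochInf (-q) q * eulerFn q = eulerFn (q ^ 2) := by
  rw [eulerFn, eulerFn, ← qPochInf_mul_neg q hq, mul_comm]

/-- Since (q²; q⁴)_∞ = (q; q²)_∞ (-q; q²)_∞, and the first two are quotients of Euler functions, so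
is the third. -/
theorem qPochInf_neg_odd_mul {q : ℂ} (hq : ‖q‖ < 1) :
    qPochInf (-q) (q ^ 2) * (eulerFn q * eulerFn (q ^ 4)) = eulerFn (q ^ 2) ^ 2 := by
  have h2 := norm_pow_lt_one hq two_ne_zero
  have h := qPochInf_mul_neg q h2
  have h' := qPochInf_odd_mul h2
  rw [← h, ← pow_mul] at h'
  rw [← qPochInf_odd_mul hq]
  linear_combination eulerFn (q ^ 2) * h'

/-! ### Reciprocal `q`-factorials and triangular numbers -/

/-- `1 / (q; q)_k`, extended by zero to negative `k`. -/
noncomputable def invQFact (q : ℂ) (k : ℤ) : ℂ :=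
  if k < 0 then 0 else (qPoch q q k.toNat)⁻¹

theorem invQFact_of_neg (q : ℂ) {k : ℤ} (hk : k < 0) : invQFact q k = 0 := if_pos hk

theorem invQFact_natCast (q : ℂ) (n : ℕ) : invQFact q n = (qPoch q q n)⁻¹ := by
  simp [invQFact]

theorem one_sub_pow_ne_zero {q : ℂ} (hq : ‖q‖ < 1) {m : ℕ} (hm : m ≠ 0) : 1 - q ^ m ≠ 0 := by
  intro h
  have h1 := norm_pow_lt_one hq hm
  rw [← sub_eq_zero.1 h] at h1
  simp at h1

theorem qPoch_self_ne_zero {q : ℂ} (hq : ‖q‖ < 1) (n : ℕ) : qPoch q q n ≠ 0 :=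
  Finset.prod_ne_zero_iff.2 fun k _ => by
    rw [← pow_succ']
    exact one_sub_pow_ne_zero hq k.succ_ne_zero

/-- At k = 0 the factor 1 - q^0 vanishes, so the recurrence has no boundary case. This lets finite
sums be handled as sums over ℤ and shifted freely. -/
theorem invQFact_sub_one {q : ℂ} (hq : ‖q‖ < 1) (k : ℤ) :
    invQFact q (k - 1) = (1 - q ^ k) * invQFact q k := by
  rcases lt_trichotomy k 0 with h | rfl | h
  · rw [invQFact_of_neg q h, invQFact_of_neg q (by omega), mul_zero]
  · rw [invQFact_of_neg q (by omega)]
    simp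
  · obtain ⟨n, rfl⟩ : ∃ n : ℕ, k = n + 1 := ⟨(k - 1).toNat, by omega⟩
    have h1 := qPoch_self_ne_zero hq (n + 1)
    rw [add_sub_cancel_right]
    rw [show ((n : ℤ) + 1) = ((n + 1 : ℕ) : ℤ) by push_cast; rfl, invQFact_natCast,
      invQFact_natCast, zpow_natCast]
    have h2 : qPoch q q (n + 1) = qPoch q q n * (1 - q ^ (n + 1)) := by
      rw [qPoch, Finset.prod_range_succ, ← pow_succ']
      rfl
    rw [h2] at h1 ⊢
    have := left_ne_zero_of_mul h1
    have := right_ne_zero_of_mul h1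
    field_simp

theorem tendsto_invQFact {q : ℂ} (hq : ‖q‖ < 1) (c : ℤ) :
    Tendsto (fun n : ℕ => invQFact q (n + c)) atTop (𝓝 (eulerFn q)⁻¹) := by
  have h1 : Tendsto (fun n : ℕ => invQFact q n) atTop (𝓝 (eulerFn q)⁻¹) :=
    ((tendsto_qPoch q hq).inv₀ (eulerFn_ne_zero hq)).congr fun n => (invQFact_natCast q n).symm
  have h2 : Tendsto (fun n : ℕ => ((n : ℤ) + c).toNat) atTop atTop :=
    tendsto_atTop.2 fun b => by
      filter_upwards [eventually_ge_atTop (b + c.natAbs)] with n hn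
      omega
  refine (h1.comp h2).congr' ?_
  filter_upwards [eventually_ge_atTop c.natAbs] with n hn
  simp only [Function.comp_apply]
  rw [Int.toNat_of_nonneg (by omega)]

theorem exists_norm_le_of_tendsto {u : ℕ → ℂ} {l : ℂ} (h : Tendsto u atTop (𝓝 l)) :
    ∃ C : ℝ, ∀ n, ‖u n‖ ≤ C := by
  obtain ⟨C, hC⟩ := h.norm.bddAbove_range
  exact ⟨C, fun n => hC ⟨n, rfl⟩⟩

theorem exists_invQFact_bound {q : ℂ} (hq : ‖q‖ < 1) :
    ∃ C : ℝ, 0 ≤ C ∧ ∀ k, ‖invQFact q k‖ ≤ C := by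
  obtain ⟨C, hC⟩ := exists_norm_le_of_tendsto (tendsto_invQFact hq 0)
  have h0 : 0 ≤ C := (norm_nonneg _).trans (hC 0)
  refine ⟨C, h0, fun k => ?_⟩
  rcases lt_or_ge k 0 with h | h
  · rw [invQFact_of_neg q h]
    simpa using h0
  · have := hC k.toNat
    rwa [add_zero, Int.toNat_of_nonneg h] at this

/-- `1 / (1 - x q ^ k)` is bounded in `k`. -/
theorem exists_inv_one_sub_bound (x : ℂ) {q : ℂ} (hq0 : q ≠ 0) (hq : ‖q‖ < 1) :
    ∃ C : ℝ, 0 ≤ C ∧ ∀ k : ℤ, ‖(1 - x * q ^ k)⁻¹‖ ≤ C := by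
  have h0 : Tendsto (fun n : ℕ => q ^ n) atTop (𝓝 0) := tendsto_pow_atTop_nhds_zero_of_norm_lt_one hq
  have h1 : Tendsto (fun n : ℕ => (1 - x * q ^ n)⁻¹) atTop (𝓝 (1 - x * 0)⁻¹) :=
    (tendsto_const_nhds.sub (h0.const_mul x)).inv₀ (by simp)
  obtain ⟨C, hC⟩ := exists_norm_le_of_tendsto h1
  have hC0 : 0 ≤ C := (norm_nonneg _).trans (hC 0)
  rcases eq_or_ne x 0 with rfl | hx
  · exact ⟨1, zero_le_one, fun k => by simp⟩
  -- For exponent -n the fraction equals q^n / (q^n - x), also at a pole, where both are 0.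
  have h2 : Tendsto (fun n : ℕ => q ^ n / (q ^ n - x)) atTop (𝓝 (0 / (0 - x))) :=
    h0.div (h0.sub tendsto_const_nhds) (by simpa using hx)
  obtain ⟨D, hD⟩ := exists_norm_le_of_tendsto h2
  refine ⟨max C D, le_max_of_le_left hC0, fun k => ?_⟩
  obtain ⟨n, rfl | rfl⟩ := k.eq_nat_or_neg
  · rw [zpow_natCast]
    exact (hC n).trans (le_max_left _ _)
  · refine le_trans (le_of_eq ?_) ((hD n).trans (le_max_right _ _))
    congr 1
    rw [zpow_neg, zpow_natCast]
    have := pow_ne_zero n hq0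
    rw [show 1 - x * (q ^ n)⁻¹ = (q ^ n - x) / q ^ n by field_simp, inv_div]

/-- The triangular number `k (k + 1) / 2`. -/
def tri (k : ℤ) : ℤ := k * (k + 1) / 2

theorem two_mul_tri (k : ℤ) : 2 * tri k = k * (k + 1) :=
  Int.mul_ediv_cancel' (Int.even_mul_succ_self k).two_dvd

theorem tri_add_one (k : ℤ) : tri (k + 1) = tri k + (k + 1) := by
  have h1 := two_mul_tri k
  have h2 := two_mul_tri (k + 1)
  linarith

theorem tri_sub_one (k : ℤ) : tri (k - 1) = tri k - k := by
  have h1 := two_mul_tri k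
  have h2 := two_mul_tri (k - 1)
  linarith

theorem tri_neg (k : ℤ) : tri (-k) = tri k - k := by
  have h1 := two_mul_tri k
  have h2 := two_mul_tri (-k)
  linarith

theorem le_tri_natCast (n : ℕ) : (n : ℤ) ≤ tri n := by
  have h1 := two_mul_tri n
  rcases n.eq_zero_or_pos with rfl | h
  · simp [tri]
  · have : (1 : ℤ) ≤ n := by exact_mod_cast h
    nlinarith

theorem zpow_le_pow_of_le {r : ℝ} (h0 : 0 < r) (h1 : r < 1) {k : ℤ} {n : ℕ} (h : (n : ℤ) ≤ k) :
    r ^ k ≤ r ^ n := by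
  rw [← zpow_natCast]
  exact zpow_le_zpow_right_of_le_one₀ h0 h1.le h

theorem summable_zpow_tri {r : ℝ} (h0 : 0 < r) (h1 : r < 1) : Summable fun k : ℤ => r ^ tri k := by
  have hg := summable_geometric_of_lt_one h0.le h1
  refine Summable.of_nat_of_neg ?_ ?_
  · exact Summable.of_nonneg_of_le (fun _ => by positivity)
      (fun n => zpow_le_pow_of_le h0 h1 (le_tri_natCast n)) hg
  · refine (summable_nat_add_iff 1).1 ?_
    refine Summable.of_nonneg_of_le (fun _ => by positivity)
      (fun n => zpow_le_pow_of_le h0 h1 ?_) hg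
    rw [tri_neg]
    push_cast
    rw [tri_add_one]
    have := le_tri_natCast n
    linarith

theorem one_sub_mul_zpow_ne_zero {x q : ℂ} (h : ∀ k : ℤ, x * q ^ k ≠ 1) (k : ℤ) :
    1 - x * q ^ k ≠ 0 := sub_ne_zero.2 (h k).symm

/-! ### Finite and infinite triple product; partial fractions of the reciprocal theta function -/

theorem HasSum.of_eq {ι : Type*} {f g : ι → ℂ} {a b : ℂ} (h : HasSum f a) (hg : ∀ i, g i = f i)
    (hb : b = a) : HasSum g b :=
  hb ▸ h.congr_fun hg

/-- The finite theta product `(x; q)_m (q / x; q)_n`. -/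
noncomputable def finTheta (q x : ℂ) (m n : ℕ) : ℂ := qPoch x q m * qPoch (q / x) q n

/-- `(x; q)_∞ (q / x; q)_∞`. -/
noncomputable def theta (q x : ℂ) : ℂ := qPochInf x q * qPochInf (q / x) q

theorem qPoch_succ (a q : ℂ) (n : ℕ) : qPoch a q (n + 1) = qPoch a q n * (1 - a * q ^ n) :=
  Finset.prod_range_succ _ _

theorem finTheta_succ_left (q x : ℂ) (m n : ℕ) :
    finTheta q x (m + 1) n = finTheta q x m n * (1 - x * q ^ m) := by
  rw [finTheta, finTheta, qPoch_succ]
  ring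

theorem finTheta_succ_right (q x : ℂ) (m n : ℕ) :
    finTheta q x m (n + 1) = finTheta q x m n * (1 - q ^ (n + 1) / x) := by
  rw [finTheta, finTheta, qPoch_succ]
  ring

theorem finTheta_one_succ (q : ℂ) (m n : ℕ) : finTheta q 1 (m + 1) n = 0 := by
  simp [finTheta, qPoch, Finset.prod_range_succ']

theorem finTheta_self_succ {q : ℂ} (hq0 : q ≠ 0) (m n : ℕ) : finTheta q q m (n + 1) = 0 := by
  simp [finTheta, qPoch, Finset.prod_range_succ', hq0]

theorem finTheta_ne_zero {q x : ℂ} (hq0 : q ≠ 0) (hx0 : x ≠ 0) (hx : ∀ k : ℤ, x * q ^ k ≠ 1)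
    (m n : ℕ) : finTheta q x m n ≠ 0 := by
  refine mul_ne_zero (Finset.prod_ne_zero_iff.2 fun k _ => ?_)
    (Finset.prod_ne_zero_iff.2 fun k _ => ?_)
  · exact_mod_cast one_sub_mul_zpow_ne_zero hx k
  · have h := hx (-(k + 1 : ℕ))
    rw [zpow_neg, zpow_natCast] at h
    contrapose! h
    have := pow_ne_zero (k + 1) hq0
    have h2 : 1 = q / x * q ^ k := sub_eq_zero.1 h
    field_simp at h2 ⊢
    rw [h2]
    ring

theorem theta_ne_zero {q x : ℂ} (hq0 : q ≠ 0) (hq : ‖q‖ < 1) (hx0 : x ≠ 0)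
    (hx : ∀ k : ℤ, x * q ^ k ≠ 1) : theta q x ≠ 0 := by
  refine mul_ne_zero (qPochInf_ne_zero hq fun k => by exact_mod_cast hx k)
    (qPochInf_ne_zero hq fun k h => ?_)
  refine hx (-(k + 1 : ℕ)) ?_
  rw [zpow_neg, zpow_natCast]
  have := pow_ne_zero (k + 1) hq0
  field_simp at h ⊢
  rw [← h]
  ring

/-- The terms of the finite triple product expansion. -/
noncomputable def tripleTerm (q z : ℂ) (m n : ℕ) (k : ℤ) : ℂ :=
  (-1) ^ k * z ^ k * q ^ tri (k - 1) * (invQFact q (m - k) * invQFact q (n + k))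

/-- Multiplying the series by 1 - z q^m subtracts a copy shifted by one index; this is the induction
step in m of the finite triple product. -/
theorem tripleTerm_succ_left {q z : ℂ} (hq0 : q ≠ 0) (hq : ‖q‖ < 1) (hz : z ≠ 0) (m n : ℕ)
    (k : ℤ) : tripleTerm q z m n k - z * q ^ m * tripleTerm q z m n (k - 1) =
      (1 - q ^ (m + n + 1)) * tripleTerm q z (m + 1) n k := by
  have hm1 : (-1 : ℂ) ≠ 0 := by norm_num
  have h1 := invQFact_sub_one hq (m + 1 - k)
  have h2 := invQFact_sub_one hq (n + k)
  rw [show (m : ℤ) + 1 - k - 1 = m - k by ring] at h1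
  simp only [tripleTerm]
  rw [show (m : ℤ) - (k - 1) = m + 1 - k by ring, show (n : ℤ) + (k - 1) = n + k - 1 by ring,
    h1, h2, tri_sub_one (k - 1)]
  push_cast
  simp only [zpow_sub₀ hq0, zpow_add₀ hq0, zpow_sub₀ hz, zpow_sub₀ hm1, zpow_natCast, zpow_one,
    pow_add, pow_one]
  have := zpow_ne_zero k hq0
  field_simp
  ring

theorem tripleTerm_succ_right {q z : ℂ} (hq0 : q ≠ 0) (hq : ‖q‖ < 1) (hz : z ≠ 0) (m n : ℕ)
    (k : ℤ) : tripleTerm q z m n k - q ^ (n + 1) / z * tripleTerm q z m n (k + 1) =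
      (1 - q ^ (m + n + 1)) * tripleTerm q z m (n + 1) k := by
  have hm1 : (-1 : ℂ) ≠ 0 := by norm_num
  have h1 := invQFact_sub_one hq (m - k)
  have h2 := invQFact_sub_one hq (n + 1 + k)
  rw [show (n : ℤ) + 1 + k - 1 = n + k by ring] at h2
  simp only [tripleTerm]
  rw [show (m : ℤ) - (k + 1) = m - k - 1 by ring, show (n : ℤ) + (k + 1) = n + 1 + k by ring,
    h1, h2, tri_sub_one k, add_sub_cancel_right]
  push_cast
  simp only [zpow_sub₀ hq0, zpow_add₀ hq0, zpow_add₀ hz, zpow_add₀ hm1, zpow_natCast, zpow_one,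
    pow_add, pow_one]
  have := zpow_ne_zero k hq0
  field_simp
  ring

/-- The finite Jacobi triple product. -/
theorem hasSum_tripleTerm {q z : ℂ} (hq0 : q ≠ 0) (hq : ‖q‖ < 1) (hz : z ≠ 0) (m n : ℕ) :
    HasSum (tripleTerm q z m n) (finTheta q z m n * invQFact q (m + n : ℕ)) := by
  have hr (j : ℕ) : invQFact q (j : ℕ) = (1 - q ^ (j + 1)) * invQFact q (j + 1 : ℕ) := by
    have := invQFact_sub_one hq (j + 1 : ℕ)
    rw [zpow_natCast] at this
    rw [← this]
    simp
  induction m with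
  | zero =>
    induction n with
    | zero =>
      convert hasSum_single (0 : ℤ) ?_ using 1
      · simp [tripleTerm, finTheta, qPoch, tri, invQFact]
      · intro k hk
        rcases lt_or_gt_of_ne hk with h | h
        · rw [tripleTerm, invQFact_of_neg q (k := ((0 : ℕ) : ℤ) + k) (by simpa using h)]
          ring
        · rw [tripleTerm, invQFact_of_neg q (k := ((0 : ℕ) : ℤ) - k) (by simpa using h)]
          ring
    | succ n ih =>
      have h1 : 1 - q ^ (n + 1) ≠ 0 := one_sub_pow_ne_zero hq n.succ_ne_zero
      have h2 := (ih.sub (((Equiv.addRight (1 : ℤ)).hasSum_iff.2 ih).mul_left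
        (q ^ (n + 1) / z))).mul_left (1 - q ^ (n + 1))⁻¹
      refine h2.of_eq (fun k => ?_) ?_
      · have := tripleTerm_succ_right hq0 hq hz 0 n k
        simp only [Function.comp_apply, Equiv.coe_addRight]
        rw [this, zero_add]
        field_simp
      · simp only [finTheta_succ_right, zero_add, hr n]
        field_simp
  | succ m ih =>
    have h1 : 1 - q ^ (m + n + 1) ≠ 0 := one_sub_pow_ne_zero hq (m + n).succ_ne_zero
    have h2 := (ih.sub (((Equiv.subRight (1 : ℤ)).hasSum_iff.2 ih).mul_left
      (z * q ^ m))).mul_left (1 - q ^ (m + n + 1))⁻¹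
    refine h2.of_eq (fun k => ?_) ?_
    · have := tripleTerm_succ_left hq0 hq hz m n k
      simp only [Function.comp_apply, Equiv.subRight_apply]
      rw [this]
      field_simp
    · rw [finTheta_succ_left, hr (m + n), show m + 1 + n = m + n + 1 by ring]
      field_simp

theorem tendsto_finTheta (x : ℂ) {q : ℂ} (hq : ‖q‖ < 1) {u v : ℕ → ℕ} (hu : Tendsto u atTop atTop)
    (hv : Tendsto v atTop atTop) :
    Tendsto (fun n => finTheta q x (u n) (v n)) atTop (𝓝 (theta q x)) :=
  ((tendsto_qPoch x hq).comp hu).mul ((tendsto_qPoch (q / x) hq).comp hv)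

theorem tendsto_invQFact_mul {q : ℂ} (hq : ‖q‖ < 1) (a b : ℤ) :
    Tendsto (fun n : ℕ => invQFact q (n + a) * invQFact q (n + b)) atTop
      (𝓝 ((eulerFn q)⁻¹ ^ 2)) := by
  rw [pow_two]
  exact (tendsto_invQFact hq a).mul (tendsto_invQFact hq b)

/-- The Jacobi triple product. -/
theorem hasSum_triple_product {q z : ℂ} (hq0 : q ≠ 0) (hq : ‖q‖ < 1) (hz : z ≠ 0)
    (hs : Summable fun k : ℤ => ‖(-1) ^ k * z ^ k * q ^ tri (k - 1)‖) :
    HasSum (fun k : ℤ => (-1) ^ k * z ^ k * q ^ tri (k - 1)) (theta q z * eulerFn q) := by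
  obtain ⟨C, hC0, hC⟩ := exists_invQFact_bound hq
  have hE := eulerFn_ne_zero hq
  -- The finite identity with m = n = N, as N → ∞.
  have key := tendsto_tsum_of_dominated_convergence (𝓕 := atTop)
    (f := fun N : ℕ => tripleTerm q z N N)
    (g := fun k : ℤ => (-1) ^ k * z ^ k * q ^ tri (k - 1) * ((eulerFn q)⁻¹ ^ 2))
    (hs.mul_right (C * C)) ?_ ?_
  · have h2 : Tendsto (fun N : ℕ => finTheta q z N N * invQFact q (N + N : ℕ)) atTop
        (𝓝 (theta q z * (eulerFn q)⁻¹)) :=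
      (tendsto_finTheta z hq tendsto_id tendsto_id).mul (by
        have := (tendsto_invQFact hq 0).comp
          (tendsto_atTop_mono (fun n : ℕ => n.le_add_right n) tendsto_id)
        refine this.congr fun n => ?_
        simp)
    have h3 := tendsto_nhds_unique (key.congr fun N => (hasSum_tripleTerm hq0 hq hz N N).tsum_eq) h2
    rw [tsum_mul_right] at h3
    have h4 := hs.of_norm.hasSum
    refine h4.of_eq (fun _ => rfl) ?_
    field_simp at h3
    rw [h3, mul_comm]
  · intro k
    refine (((tendsto_invQFact_mul hq (-k) k)).const_mul _).congr fun n => ?_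
    rw [tripleTerm, ← sub_eq_add_neg]
  · refine Eventually.of_forall fun N k => ?_
    rw [tripleTerm, norm_mul, norm_mul (invQFact _ _)]
    gcongr
    · exact hC _
    · exact hC _

/-- The terms of the partial fraction expansion of `1 / finTheta`. -/
noncomputable def polarTerm (q x : ℂ) (m n : ℕ) (k : ℤ) : ℂ :=
  (-1) ^ k * q ^ tri k * (invQFact q (m - 1 - k) * invQFact q (n + k)) * (1 - x * q ^ k)⁻¹

/-- Partial fractions of the reciprocal of a finite theta product. -/
theorem hasSum_polarTerm {q x : ℂ} (hq0 : q ≠ 0) (hq : ‖q‖ < 1) (hx0 : x ≠ 0)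
    (hx : ∀ k : ℤ, x * q ^ k ≠ 1) (m n : ℕ) :
    HasSum (polarTerm q x (m + 1) n) (finTheta q x (m + 1) n)⁻¹ := by
  have hk := one_sub_mul_zpow_ne_zero hx
  have hp (k : ℤ) := zpow_ne_zero k hq0
  induction m with
  | zero =>
    induction n with
    | zero =>
      convert hasSum_single (0 : ℤ) ?_ using 1
      · simp [polarTerm, finTheta, qPoch, tri, invQFact]
      · intro k hk
        rcases lt_or_gt_of_ne hk with h | h
        · rw [polarTerm, invQFact_of_neg q (k := ((0 : ℕ) : ℤ) + k) (by simpa using h)]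
          ring
        · rw [polarTerm, invQFact_of_neg q (k := ((0 + 1 : ℕ) : ℤ) - 1 - k) (by simpa using h)]
          ring
    | succ n ih =>
      have h1 : 1 - q ^ (n + 1) / x ≠ 0 := by
        have := hk (-(n + 1 : ℕ))
        rw [zpow_neg, zpow_natCast] at this
        contrapose! this
        have := pow_ne_zero (n + 1) hq0
        have h2 : 1 = q ^ (n + 1) / x := sub_eq_zero.1 ‹_›
        field_simp at h2 ⊢
        rw [h2]
        ring
      -- At z = q the finite triple product has the factor 1 - q / z = 0. Subtracting a multiple of
      -- this null series raises n by one.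
      have h0 := hasSum_tripleTerm hq0 hq hq0 0 (n + 1)
      rw [finTheta_self_succ hq0, zero_mul] at h0
      have h2 := (ih.sub (h0.mul_left (q ^ (n + 1) / x))).mul_left (1 - q ^ (n + 1) / x)⁻¹
      refine h2.of_eq (fun k => ?_) ?_
      · have h3 := invQFact_sub_one hq (n + 1 + k)
        rw [show (n : ℤ) + 1 + k - 1 = n + k by ring] at h3
        simp only [polarTerm, tripleTerm, tri_sub_one]
        push_cast
        rw [h3]
        rw [inv_mul_eq_div, eq_div_iff h1, zpow_add₀ hq0, zpow_add₀ hq0, zpow_sub₀ hq0,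
          zpow_natCast, zpow_one]
        have := hk k
        have := hp k
        field_simp
        ring
      · rw [finTheta_succ_right, mul_inv, mul_zero, sub_zero, mul_comm]
  | succ m ih =>
    have h1 : 1 - x * q ^ (m + 1) ≠ 0 := by exact_mod_cast hk (m + 1 : ℕ)
    -- At z = 1 the factor 1 - z vanishes; adding a multiple of this null series raises m.
    have h0 := hasSum_tripleTerm hq0 hq one_ne_zero (m + 1) n
    rw [finTheta_one_succ, zero_mul] at h0
    have h2 := (ih.add (h0.mul_left (q ^ (m + 1)))).mul_left (1 - x * q ^ (m + 1))⁻¹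
    refine h2.of_eq (fun k => ?_) ?_
    · have h3 := invQFact_sub_one hq (m + 1 - k)
      simp only [polarTerm, tripleTerm, tri_sub_one]
      push_cast
      rw [show (m : ℤ) + 1 - 1 - k = m + 1 - k - 1 by ring, h3,
        show (m : ℤ) + 1 + 1 - 1 - k = m + 1 - k by ring]
      rw [inv_mul_eq_div, eq_div_iff h1]
      simp only [zpow_add₀ hq0, zpow_sub₀ hq0, zpow_natCast, zpow_one, one_zpow]
      have := hk k
      have := hp k
      field_simp
      ring
    · rw [finTheta_succ_left, mul_inv, mul_zero, add_zero, mul_comm]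

theorem summable_norm_neg_one_zpow_tri {q : ℂ} (hq0 : q ≠ 0) (hq : ‖q‖ < 1) :
    Summable fun k : ℤ => ‖(-1) ^ k * q ^ tri k‖ := by
  simpa using summable_zpow_tri (norm_pos_iff.2 hq0) hq

/-- Partial fractions of the reciprocal of a theta function. -/
theorem hasSum_inv_theta {q x : ℂ} (hq0 : q ≠ 0) (hq : ‖q‖ < 1) (hx0 : x ≠ 0)
    (hx : ∀ k : ℤ, x * q ^ k ≠ 1) :
    HasSum (fun k : ℤ => (-1) ^ k * q ^ tri k * (1 - x * q ^ k)⁻¹)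
      (eulerFn q ^ 2 * (theta q x)⁻¹) := by
  obtain ⟨C, hC0, hC⟩ := exists_invQFact_bound hq
  obtain ⟨D, hD0, hD⟩ := exists_inv_one_sub_bound x hq0 hq
  have hE := eulerFn_ne_zero hq
  have hs := summable_norm_neg_one_zpow_tri hq0 hq
  have key := tendsto_tsum_of_dominated_convergence (𝓕 := atTop)
    (f := fun N : ℕ => polarTerm q x (N + 1) N)
    (g := fun k : ℤ => (-1) ^ k * q ^ tri k * ((eulerFn q)⁻¹ ^ 2) * (1 - x * q ^ k)⁻¹)
    ((hs.mul_right (C * C)).mul_right D) ?_ ?_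
  · have h2 := (tendsto_finTheta x hq (tendsto_add_atTop_nat 1) tendsto_id).inv₀
      (theta_ne_zero hq0 hq hx0 hx)
    have h3 := tendsto_nhds_unique
      (key.congr fun N => (hasSum_polarTerm hq0 hq hx0 hx N N).tsum_eq) h2
    have h4 : Summable fun k : ℤ => (-1) ^ k * q ^ tri k * (1 - x * q ^ k)⁻¹ := by
      refine (hs.mul_right D).of_norm_bounded fun k => ?_
      rw [norm_mul]
      gcongr
      exact hD k
    refine h4.hasSum.of_eq (fun _ => rfl) ?_
    rw [← h3, ← tsum_mul_left]
    refine tsum_congr fun k => ?_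
    field_simp
  · intro k
    refine (((tendsto_invQFact_mul hq (-k) k).const_mul _).mul_const _).congr fun n => ?_
    rw [polarTerm]
    push_cast
    rw [show (n : ℤ) + 1 - 1 - k = n + -k by ring]
  · refine Eventually.of_forall fun N k => ?_
    rw [polarTerm, norm_mul, norm_mul, norm_mul (invQFact _ _)]
    gcongr
    · exact hC _
    · exact hC _
    · exact hD _

/-! ### Cauchy's identity and Lambert series of the universal mock theta function -/

/-- The terms of Cauchy's series `∑ q ^ (j (j + a)) / ((q; q)_j (q; q)_{j + a})`. -/
noncomputable def cauchyTerm (q : ℂ) (a j : ℕ) : ℂ :=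
  q ^ (j * (j + a)) * (invQFact q j * invQFact q (j + a : ℕ))

theorem pow_mul_add_le {r : ℝ} (h0 : 0 ≤ r) (h1 : r ≤ 1) (a j : ℕ) : r ^ (j * (j + a)) ≤ r ^ j :=
  pow_le_pow_of_le_one h0 h1 (by nlinarith [j.le_mul_self, Nat.zero_le (j * a)])

theorem norm_cauchyTerm_le {q : ℂ} (hq : ‖q‖ < 1) {C : ℝ} (hC : ∀ k, ‖invQFact q k‖ ≤ C)
    (a j : ℕ) : ‖cauchyTerm q a j‖ ≤ ‖q‖ ^ j * (C * C) := by
  have hC0 := (norm_nonneg _).trans (hC 0)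
  rw [cauchyTerm, norm_mul, norm_mul (invQFact _ _), norm_pow]
  exact mul_le_mul (pow_mul_add_le (norm_nonneg _) hq.le a j)
    (mul_le_mul (hC _) (hC _) (norm_nonneg _) hC0) (by positivity) (by positivity)

theorem summable_cauchyTerm {q : ℂ} (hq : ‖q‖ < 1) (a : ℕ) : Summable (cauchyTerm q a) := by
  obtain ⟨C, -, hC⟩ := exists_invQFact_bound hq
  exact ((summable_geometric_of_lt_one (norm_nonneg q) hq).mul_right (C * C)).of_norm_bounded
    (norm_cauchyTerm_le hq hC a)

/-- Over the denominator (q; q)_j (q; q)_{j+a+1} the difference of terms carries the factor (1 -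
q^j) - q^(j+a+1). The first piece lowers (q; q)_j and, after j ↦ j + 1, is a term for a + 2; the
second is a term for a + 1. -/
theorem tsum_cauchyTerm_sub {q : ℂ} (hq : ‖q‖ < 1) (a : ℕ) :
    ∑' j, cauchyTerm q a j - ∑' j, cauchyTerm q (a + 1) j =
      q ^ (a + 1) * (∑' j, cauchyTerm q (a + 2) j - ∑' j, cauchyTerm q (a + 1) j) := by
  have h0 := (summable_cauchyTerm hq a).hasSum
  have h1 := (summable_cauchyTerm hq (a + 1)).hasSum
  have h2 := (summable_cauchyTerm hq (a + 2)).hasSum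
  have hU : HasSum (fun j : ℕ => q ^ (j * (j + a)) * (invQFact q (j - 1) *
      invQFact q (j + (a + 1) : ℕ))) (q ^ (a + 1) * ∑' j, cauchyTerm q (a + 2) j) := by
    rw [← hasSum_nat_add_iff' 1]
    refine (h2.mul_left (q ^ (a + 1))).of_eq (fun j => ?_) ?_
    · rw [cauchyTerm, show j + 1 + (a + 1) = j + (a + 2) by ring]
      push_cast
      rw [add_sub_cancel_right]
      ring
    · simp [invQFact_of_neg]
  have h3 := hU.sub (h1.mul_left (q ^ (a + 1)))
  rw [mul_sub]
  refine (h0.sub h1).unique (h3.of_eq (fun j => ?_) rfl)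
  have e1 := invQFact_sub_one hq j
  have e2 := invQFact_sub_one hq (j + (a + 1) : ℕ)
  rw [zpow_natCast] at e1 e2
  rw [show ((j + (a + 1) : ℕ) : ℤ) - 1 = (j + a : ℕ) by push_cast; ring] at e2
  rw [cauchyTerm, cauchyTerm, e1, e2]
  ring

/-- Iterating the previous relation bounds the difference by ‖q‖^n times a fixed constant, for every
n. -/
theorem tsum_cauchyTerm_eq_succ {q : ℂ} (hq : ‖q‖ < 1) (a : ℕ) :
    ∑' j, cauchyTerm q a j = ∑' j, cauchyTerm q (a + 1) j := by
  obtain ⟨C, -, hC⟩ := exists_invQFact_bound hq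
  set S := fun a => ∑' j, cauchyTerm q a j with hS
  set B := ∑' j : ℕ, ‖q‖ ^ j * (C * C) with hB
  have hb (a : ℕ) : ‖S a‖ ≤ B :=
    tsum_of_norm_bounded ((summable_geometric_of_lt_one (norm_nonneg q) hq).mul_right
      (C * C)).hasSum (norm_cauchyTerm_le hq hC a)
  have hstep (n a : ℕ) : ‖S a - S (a + 1)‖ ≤ ‖q‖ ^ n * (B + B) := by
    induction n generalizing a with
    | zero => simpa using (norm_sub_le _ _).trans (add_le_add (hb a) (hb (a + 1)))
    | succ n ih =>
      rw [hS]
      simp only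
      rw [tsum_cauchyTerm_sub hq, norm_mul, norm_pow, pow_succ' _ n, mul_assoc, norm_sub_rev]
      refine mul_le_mul ?_ (ih (a + 1)) (norm_nonneg _) (norm_nonneg _)
      simpa using pow_le_pow_of_le_one (norm_nonneg q) hq.le (Nat.le_add_left 1 a)
  have h0 : Tendsto (fun n : ℕ => ‖q‖ ^ n * (B + B)) atTop (𝓝 (0 * (B + B))) :=
    (tendsto_pow_atTop_nhds_zero_of_lt_one (norm_nonneg q) hq).mul_const _
  have := ge_of_tendsto' h0 (fun n => hstep n a)
  rw [zero_mul, norm_le_zero_iff, sub_eq_zero] at this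
  exact this

/-- Cauchy's identity. -/
theorem hasSum_cauchyTerm {q : ℂ} (hq : ‖q‖ < 1) (a : ℕ) :
    HasSum (cauchyTerm q a) (eulerFn q)⁻¹ := by
  obtain ⟨C, -, hC⟩ := exists_invQFact_bound hq
  have hconst (n : ℕ) : ∑' j, cauchyTerm q (a + n) j = ∑' j, cauchyTerm q a j := by
    induction n with
    | zero => rfl
    | succ n ih => rw [← ih, ← add_assoc, ← tsum_cauchyTerm_eq_succ hq]
  -- The sum does not depend on a; as a → ∞ only j = 0 survives.
  have key := tendsto_tsum_of_dominated_convergence (𝓕 := atTop)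
    (f := fun n : ℕ => cauchyTerm q (a + n))
    (g := fun j : ℕ => if j = 0 then (eulerFn q)⁻¹ else 0)
    ((summable_geometric_of_lt_one (norm_nonneg q) hq).mul_right (C * C)) ?_ ?_
  · simp only [hconst, tsum_ite_eq] at key
    exact (summable_cauchyTerm hq a).hasSum_iff.2 (tendsto_nhds_unique tendsto_const_nhds key)
  · intro j
    rcases eq_or_ne j 0 with rfl | hj
    · have := tendsto_invQFact hq a
      simp only [if_true]
      refine this.congr fun n => ?_
      simp [cauchyTerm, invQFact, qPoch, add_comm]
    · rw [if_neg hj]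
      refine squeeze_zero_norm (a := fun n => ‖q‖ ^ n * (C * C)) (fun n => ?_) ?_
      · have hC0 := (norm_nonneg _).trans (hC 0)
        rw [cauchyTerm, norm_mul, norm_mul (invQFact _ _), norm_pow]
        refine mul_le_mul (pow_le_pow_of_le_one (norm_nonneg _) hq.le ?_)
          (mul_le_mul (hC _) (hC _) (norm_nonneg _) hC0) (by positivity) (by positivity)
        have := Nat.pos_of_ne_zero hj
        nlinarith
      · simpa using (tendsto_pow_atTop_nhds_zero_of_lt_one (norm_nonneg q) hq).mul_const (C * C)
  · exact Eventually.of_forall fun n => norm_cauchyTerm_le hq hC _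

/-- For n = j + k one has n² + en = k² + ek + j (j + 2k + e), so this is Cauchy's series with a = 2k
+ e. Negative k reduce to this by k ↦ -e - k, which swaps the two factors; e ≤ 1 makes the reflected
index non-negative. -/
theorem hasSum_cauchy_center {q : ℂ} (hq : ‖q‖ < 1) {e : ℕ} (he : e ≤ 1) (k : ℤ) :
    HasSum (fun n : ℕ => q ^ (n ^ 2 + e * n) * (invQFact q (n - k) * invQFact q (n + e + k)))
      (q ^ (k ^ 2 + e * k) * (eulerFn q)⁻¹) := by
  have main (k : ℕ) : HasSum (fun n : ℕ => q ^ (n ^ 2 + e * n) *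
      (invQFact q (n - k) * invQFact q (n + e + k))) (q ^ (k ^ 2 + e * k) * (eulerFn q)⁻¹) := by
    refine ((add_left_injective k).hasSum_iff ?_).1 ?_
    · intro n hn
      rw [invQFact_of_neg]
      · simp
      · by_contra h
        exact hn ⟨n - k, by simp only; omega⟩
    · refine ((hasSum_cauchyTerm hq (2 * k + e)).mul_left (q ^ (k ^ 2 + e * k))).of_eq
        (fun j => ?_) rfl
      simp only [Function.comp_apply]
      rw [cauchyTerm, show (j + k) ^ 2 + e * (j + k) = k ^ 2 + e * k + j * (j + (2 * k + e)) by ring,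
        pow_add]
      push_cast
      rw [add_sub_cancel_right, show (j : ℤ) + k + e + k = j + (2 * k + e) by ring, mul_assoc]
  rcases lt_or_ge k 0 with h | h
  · obtain ⟨m, rfl⟩ : ∃ m : ℕ, k = -e - m := ⟨(-e - k).toNat, by omega⟩
    refine (main m).of_eq (fun n => ?_) ?_
    · rw [mul_comm (invQFact q _)]
      congr 3 <;> ring
    · rw [← zpow_natCast]
      congr 2
      push_cast
      ring
  · obtain ⟨m, rfl⟩ := Int.eq_ofNat_of_zero_le h
    exact_mod_cast main m

theorem norm_polarTerm_le {q x : ℂ} {C D : ℝ} (hC : ∀ k, ‖invQFact q k‖ ≤ C)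
    (hD : ∀ k : ℤ, ‖(1 - x * q ^ k)⁻¹‖ ≤ D) (m n : ℕ) (k : ℤ) :
    ‖polarTerm q x m n k‖ ≤ ‖q‖ ^ tri k * (C * C * D) := by
  have hC0 := (norm_nonneg _).trans (hC 0)
  have h1 : ‖invQFact q (m - 1 - k) * invQFact q (n + k) * (1 - x * q ^ k)⁻¹‖ ≤ C * C * D := by
    rw [norm_mul, norm_mul]
    exact mul_le_mul (mul_le_mul (hC _) (hC _) (norm_nonneg _) hC0) (hD _) (norm_nonneg _)
      (mul_nonneg hC0 hC0)
  rw [polarTerm, mul_assoc, norm_mul]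
  simp only [norm_mul ((-1 : ℂ) ^ k), norm_zpow, norm_neg, norm_one, one_zpow, one_mul]
  exact mul_le_mul_of_nonneg_left h1 (zpow_nonneg (norm_nonneg _) _)

theorem summable_pow_mul_polarTerm {q : ℂ} (hq0 : q ≠ 0) (hq : ‖q‖ < 1) (x : ℂ) (e : ℕ) :
    Summable fun p : ℕ × ℤ => q ^ (p.1 ^ 2 + e * p.1) *
      polarTerm q x (p.1 + 1) (p.1 + e) p.2 := by
  obtain ⟨C, -, hC⟩ := exists_invQFact_bound hq
  obtain ⟨D, -, hD⟩ := exists_inv_one_sub_bound x hq0 hq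
  have h1 := (summable_geometric_of_lt_one (norm_nonneg q) hq).mul_of_nonneg
    (summable_zpow_tri (norm_pos_iff.2 hq0) hq) (fun _ => pow_nonneg (norm_nonneg _) _)
    (fun _ => zpow_nonneg (norm_nonneg _) _)
  refine (h1.mul_right (C * C * D)).of_norm_bounded fun p => ?_
  have e1 : ‖q‖ ^ (p.1 ^ 2 + e * p.1) ≤ ‖q‖ ^ p.1 :=
    pow_le_pow_of_le_one (norm_nonneg _) hq.le
      (by nlinarith [p.1.le_mul_self, Nat.zero_le (e * p.1)])
  rw [norm_mul, norm_pow, mul_assoc]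
  exact mul_le_mul e1 (norm_polarTerm_le hC hD _ _ _) (norm_nonneg _)
    (pow_nonneg (norm_nonneg _) _)

/-- Expand each reciprocal product in partial fractions and sum over n first: Cauchy's identity
evaluates the sum attached to each pole. The case e = 0 is the defining series of g, and e = 1 its
second form. -/
theorem exists_lambert {q x : ℂ} (hq0 : q ≠ 0) (hq : ‖q‖ < 1) (hx0 : x ≠ 0)
    (hx : ∀ k : ℤ, x * q ^ k ≠ 1) {e : ℕ} (he : e ≤ 1) :
    ∃ T : ℂ, HasSum (fun n : ℕ => q ^ (n ^ 2 + e * n) * (finTheta q x (n + 1) (n + e))⁻¹) T ∧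
      HasSum (fun k : ℤ => (-1) ^ k * q ^ (tri k + k ^ 2 + e * k) * (1 - x * q ^ k)⁻¹)
        (eulerFn q * T) := by
  have hE := eulerFn_ne_zero hq
  obtain ⟨T, hT⟩ := summable_pow_mul_polarTerm hq0 hq x e
  have hrow (n : ℕ) : HasSum (fun k : ℤ => q ^ (n ^ 2 + e * n) * polarTerm q x (n + 1) (n + e) k)
      (q ^ (n ^ 2 + e * n) * (finTheta q x (n + 1) (n + e))⁻¹) :=
    (hasSum_polarTerm hq0 hq hx0 hx n (n + e)).mul_left _
  refine ⟨T, hT.prod_fiberwise hrow, ?_⟩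
  have h1 : HasSum (fun p : ℤ × ℕ => q ^ (p.2 ^ 2 + e * p.2) *
      polarTerm q x (p.2 + 1) (p.2 + e) p.1) T := (Equiv.prodComm ℤ ℕ).hasSum_iff.2 hT
  have h2 := h1.prod_fiberwise fun k => (hasSum_cauchy_center hq he k).mul_left
    ((-1) ^ k * q ^ tri k * (1 - x * q ^ k)⁻¹) |>.of_eq (fun n => by
      simp only [polarTerm]
      push_cast
      rw [add_sub_cancel_right]
      ring) rfl
  refine (h2.mul_left (eulerFn q)).of_eq (fun k => ?_) rfl
  rw [add_assoc, zpow_add₀ hq0]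
  field_simp

/-- The Lambert series of `1 + x g(x; q)`. -/
theorem hasSum_one_add_mul_mockG {q x : ℂ} (hq0 : q ≠ 0) (hq : ‖q‖ < 1) (hx0 : x ≠ 0)
    (hx : ∀ k : ℤ, x * q ^ k ≠ 1) :
    HasSum (fun k : ℤ => (-1) ^ k * q ^ (tri k + k ^ 2) * (1 - x * q ^ k)⁻¹)
      (eulerFn q * (1 + x * mockG x q)) := by
  obtain ⟨T, h1, h2⟩ := exists_lambert hq0 hq hx0 hx (Nat.zero_le 1)
  refine h2.of_eq (fun k => by simp) ?_
  have h3 : ∑' n : ℕ, q ^ n ^ 2 / (qPoch x q (n + 1) * qPoch (q / x) q n) = T := by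
    rw [← h1.tsum_eq]
    refine tsum_congr fun n => ?_
    simp [finTheta, div_eq_mul_inv]
  rw [mockG, h3]
  field_simp
  ring

/-- The second form of the universal mock theta function. -/
theorem hasSum_mockG {q x : ℂ} (hq0 : q ≠ 0) (hq : ‖q‖ < 1) (hx0 : x ≠ 0)
    (hx : ∀ k : ℤ, x * q ^ k ≠ 1) :
    HasSum (fun n : ℕ => q ^ (n ^ 2 + n) * (finTheta q x (n + 1) (n + 1))⁻¹) (mockG x q) := by
  obtain ⟨T, h1, -⟩ := exists_lambert hq0 hq hx0 hx (Nat.zero_le 1)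
  obtain ⟨U, h2, -⟩ := exists_lambert hq0 hq hx0 hx le_rfl
  simp only [zero_mul, add_zero, one_mul] at h1 h2
  have h3 : HasSum (fun n : ℕ => x * (q ^ (n ^ 2 + n) * (finTheta q x (n + 1) (n + 1))⁻¹) -
      q ^ n ^ 2 * (finTheta q x (n + 1) n)⁻¹) (x * U - T) := (h2.mul_left x).sub h1
  have hne := finTheta_ne_zero hq0 hx0 hx
  -- The combination telescopes through q^(n²) / ((x; q)_n (q/x; q)_n), which tends to 0, so x U - T
  -- = -1.
  have h4 (N : ℕ) : ∑ n ∈ Finset.range N, (x * (q ^ (n ^ 2 + n) *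
      (finTheta q x (n + 1) (n + 1))⁻¹) - q ^ n ^ 2 * (finTheta q x (n + 1) n)⁻¹) =
      q ^ N ^ 2 * (finTheta q x N N)⁻¹ - 1 := by
    have : (1 : ℂ) = q ^ 0 ^ 2 * (finTheta q x 0 0)⁻¹ := by simp [finTheta, qPoch]
    rw [this, ← Finset.sum_range_sub (fun n => q ^ n ^ 2 * (finTheta q x n n)⁻¹)]
    refine Finset.sum_congr rfl fun n _ => ?_
    have e1 := hne (n + 1) (n + 1)
    rw [finTheta_succ_right, finTheta_succ_left] at e1
    rw [finTheta_succ_right, finTheta_succ_left]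
    have e2 := right_ne_zero_of_mul e1
    have e3 := left_ne_zero_of_mul e1
    have e4 := right_ne_zero_of_mul e3
    have e5 := left_ne_zero_of_mul e3
    have e6 : x - q ^ (n + 1) ≠ 0 := by
      contrapose! e2
      rw [← sub_eq_zero.1 e2, div_self hx0, sub_self]
    field_simp
    ring
  have h5 : Tendsto (fun N : ℕ => q ^ N ^ 2 * (finTheta q x N N)⁻¹ - 1) atTop
      (𝓝 (0 * (theta q x)⁻¹ - 1)) := by
    refine (Tendsto.mul ?_ ((tendsto_finTheta x hq tendsto_id tendsto_id).inv₀
      (theta_ne_zero hq0 hq hx0 hx))).sub_const 1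
    exact (tendsto_pow_atTop_nhds_zero_of_norm_lt_one hq).comp
      (tendsto_atTop_mono (fun n => Nat.le_self_pow two_ne_zero n) tendsto_id)
  have h6 := tendsto_nhds_unique h3.tendsto_sum_nat (h5.congr fun N => (h4 N).symm)
  refine h2.of_eq (fun _ => rfl) ?_
  have h7 : ∑' n : ℕ, q ^ n ^ 2 / (qPoch x q (n + 1) * qPoch (q / x) q n) = T := by
    rw [← h1.tsum_eq]
    exact tsum_congr fun n => by rw [finTheta, div_eq_mul_inv]
  rw [mockG, h7]
  field_simp
  linear_combination -h6

/-- The Lambert series of `g(x; q)`. -/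
theorem hasSum_mockG_lambert {q x : ℂ} (hq0 : q ≠ 0) (hq : ‖q‖ < 1) (hx0 : x ≠ 0)
    (hx : ∀ k : ℤ, x * q ^ k ≠ 1) :
    HasSum (fun k : ℤ => (-1) ^ k * q ^ (3 * tri k) * (1 - x * q ^ k)⁻¹)
      (eulerFn q * mockG x q) := by
  obtain ⟨U, h2, h3⟩ := exists_lambert hq0 hq hx0 hx le_rfl
  have h4 := hasSum_mockG hq0 hq hx0 hx
  simp only [one_mul] at h2
  rw [← h2.unique h4]
  refine h3.of_eq (fun k => ?_) rfl
  congr 3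
  have := two_mul_tri k
  push_cast
  linarith

/-! ### Watson's relation between the third order mock theta functions -/

theorem theta_mul_self {q x : ℂ} (hq0 : q ≠ 0) (hq : ‖q‖ < 1) (hx0 : x ≠ 0) :
    theta q (x * q) = -x⁻¹ * theta q x := by
  have h1 := qPochInf_shift x hq
  have h2 := qPochInf_shift (q / (x * q)) hq
  rw [show q / (x * q) * q = q / x by field_simp] at h2
  rw [theta, theta, h1, h2]
  field_simp
  ring

/-- The left side divided by (-x)^k is unchanged by k ↦ k + 1, so induction in both directions
starts from k = 0. -/
theorem theta_mul_zpow_neg {q x : ℂ} (hq0 : q ≠ 0) (hq : ‖q‖ < 1) (hx0 : x ≠ 0) (k : ℤ) :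
    theta q (x * q ^ (-k)) * q ^ tri k = (-x) ^ k * theta q x := by
  have step (k : ℤ) : theta q (x * q ^ (-k)) * q ^ tri k / (-x) ^ k =
      theta q (x * q ^ (-(k + 1))) * q ^ tri (k + 1) / (-x) ^ (k + 1) := by
    have h := theta_mul_self (x := x * q ^ (-(k + 1))) hq0 hq
      (mul_ne_zero hx0 (zpow_ne_zero _ hq0))
    have e : x * q ^ (-(k + 1)) * q = x * q ^ (-k) := by
      rw [neg_add, zpow_add₀ hq0, zpow_neg q 1, zpow_one]
      field_simp
    rw [e] at h
    rw [h, tri_add_one, zpow_add₀ hq0 (tri k), zpow_add₀ (neg_ne_zero.2 hx0), zpow_neg]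
    have := zpow_ne_zero (k + 1) hq0
    have := zpow_ne_zero k (neg_ne_zero.2 hx0)
    simp only [zpow_one]
    field_simp
  have h0 : theta q (x * q ^ (-k)) * q ^ tri k / (-x) ^ k = theta q x := by
    induction k with
    | zero => simp [tri]
    | succ n ih => rw [← step, ih]
    | pred n ih => rw [step, sub_add_cancel, ih]
  rw [← h0]
  have := zpow_ne_zero k (neg_ne_zero.2 hx0)
  field_simp

/-- The expansion of the reciprocal theta at x / q, with the index shifted by one. The extra q^k is
what later completes the exponent 3k(k+1)/2. -/
theorem hasSum_inv_mul_theta {q x : ℂ} (hq0 : q ≠ 0) (hq : ‖q‖ < 1) (hx0 : x ≠ 0)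
    (hx : ∀ k : ℤ, x * q ^ k ≠ 1) :
    HasSum (fun k : ℤ => (-1) ^ k * q ^ (tri k + k) * (1 - x * q ^ k)⁻¹)
      (eulerFn q ^ 2 * (x * theta q x)⁻¹) := by
  have hsh (k : ℤ) : x / q * q ^ (k + 1) = x * q ^ k := by
    rw [zpow_add_one₀ hq0]
    field_simp
  have h1 := hasSum_inv_theta hq0 hq (div_ne_zero hx0 hq0) (fun k => by
    rw [← sub_add_cancel k 1, hsh]
    exact hx _)
  have h2 := theta_mul_self hq0 hq (div_ne_zero hx0 hq0)
  rw [div_mul_cancel₀ _ hq0] at h2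
  have hm1 : (-1 : ℂ) ≠ 0 := by norm_num
  refine (((Equiv.addRight (1 : ℤ)).hasSum_iff.2 h1).mul_left (-q⁻¹)).of_eq (fun k => ?_) ?_
  · simp only [Function.comp_apply, Equiv.coe_addRight]
    rw [hsh, tri_add_one, ← add_assoc, zpow_add_one₀ hq0, zpow_add_one₀ hm1]
    field_simp
  · rw [h2]
    by_cases h : theta q (x / q) = 0
    · simp [h]
    · field_simp

/-- Decomposition in x at the simple poles 1/u, 1/v and -1/v; each coefficient is the remaining
factor evaluated at the pole. -/
theorem three_pole_partial_fraction {u v x : ℂ} (hu : u ≠ 0) (hv : v ≠ 0) (h1 : 1 - u * x ≠ 0)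
    (h2 : 1 - v * x ≠ 0) (h3 : 1 + v * x ≠ 0) (h4 : 1 - u / v ≠ 0) (h5 : 1 + u / v ≠ 0) :
    (1 - u * x)⁻¹ * (1 - v ^ 2 * x ^ 2)⁻¹ = (1 - u * x)⁻¹ * (1 - v ^ 2 / u ^ 2)⁻¹ +
      ((1 - v * x)⁻¹ * (1 - u / v)⁻¹ + (1 + v * x)⁻¹ * (1 + u / v)⁻¹) / 2 := by
  have e4 : v - u ≠ 0 := by
    contrapose! h4
    rw [← sub_eq_zero.1 h4, div_self hv, sub_self]
  have e5 : v + u ≠ 0 := by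
    contrapose! h5
    rw [show u = -v by linear_combination h5, neg_div, div_self hv]
    ring
  rw [show 1 - v ^ 2 * x ^ 2 = (1 - v * x) * (1 + v * x) by ring,
    show 1 - v ^ 2 / u ^ 2 = -((v - u) * (v + u)) / u ^ 2 by field_simp; ring,
    show 1 - u / v = (v - u) / v by field_simp, show 1 + u / v = (v + u) / v by field_simp]
  clear h4 h5
  rw [inv_div, inv_div, inv_div, mul_inv (1 - v * x)]
  generalize ha : 1 - v * x = a at *
  generalize hb : 1 + v * x = b at *
  generalize hc : 1 - u * x = c at *
  generalize hd : v - u = d at *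
  generalize he : v + u = e at *
  field_simp
  subst ha hb hc hd he
  ring

/-- The common bound M makes all three pieces of the double series absolutely summable, so in each
the sum can be taken first over the index not occurring in the pole in x. -/
theorem exists_partial_fraction_mul {A B u v : ℤ → ℂ} {x F G : ℂ} {M : ℝ} {f g g' : ℤ → ℂ}
    (hA : Summable fun k => ‖A k‖) (hB : Summable fun l => ‖B l‖)
    (hu0 : ∀ k, u k ≠ 0) (hv0 : ∀ l, v l ≠ 0)
    (h1 : ∀ k, 1 - u k * x ≠ 0) (h2 : ∀ l, 1 - v l * x ≠ 0) (h3 : ∀ l, 1 + v l * x ≠ 0)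
    (h4 : ∀ k l, 1 - u k / v l ≠ 0) (h5 : ∀ k l, 1 + u k / v l ≠ 0)
    (b1 : ∀ k, ‖(1 - u k * x)⁻¹‖ ≤ M) (b2 : ∀ l, ‖(1 - v l * x)⁻¹‖ ≤ M)
    (b3 : ∀ l, ‖(1 + v l * x)⁻¹‖ ≤ M) (b4 : ∀ k l, ‖(1 - u k / v l)⁻¹‖ ≤ M)
    (b5 : ∀ k l, ‖(1 + u k / v l)⁻¹‖ ≤ M) (b6 : ∀ k l, ‖(1 - v l ^ 2 / u k ^ 2)⁻¹‖ ≤ M)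
    (hF : HasSum (fun k => A k * (1 - u k * x)⁻¹) F)
    (hG : HasSum (fun l => B l * (1 - v l ^ 2 * x ^ 2)⁻¹) G)
    (hf : ∀ k, HasSum (fun l => B l * (1 - v l ^ 2 / u k ^ 2)⁻¹) (f k))
    (hg : ∀ l, HasSum (fun k => A k * (1 - u k / v l)⁻¹) (g l))
    (hg' : ∀ l, HasSum (fun k => A k * (1 + u k / v l)⁻¹) (g' l)) :
    ∃ s₁ s₂ s₃, F * G = s₁ + (s₂ + s₃) / 2 ∧
      HasSum (fun k => A k * (1 - u k * x)⁻¹ * f k) s₁ ∧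
      HasSum (fun l => B l * (1 - v l * x)⁻¹ * g l) s₂ ∧
      HasSum (fun l => B l * (1 + v l * x)⁻¹ * g' l) s₃ := by
  have hM : 0 ≤ M := (norm_nonneg _).trans (b1 0)
  have hs : Summable fun p : ℤ × ℤ => ‖A p.1‖ * ‖B p.2‖ * (M * M) :=
    (hA.mul_of_nonneg hB (fun _ => norm_nonneg _) (fun _ => norm_nonneg _)).mul_right _
  have hbound {a b c d : ℂ} (hc : ‖c‖ ≤ M) (hd : ‖d‖ ≤ M) :
      ‖a * b * (c * d)‖ ≤ ‖a‖ * ‖b‖ * (M * M) := by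
    rw [norm_mul, norm_mul, norm_mul c]
    exact mul_le_mul_of_nonneg_left (mul_le_mul hc hd (norm_nonneg _) hM) (by positivity)
  obtain ⟨s₁, hs₁⟩ : Summable fun p : ℤ × ℤ =>
      A p.1 * B p.2 * ((1 - u p.1 * x)⁻¹ * (1 - v p.2 ^ 2 / u p.1 ^ 2)⁻¹) :=
    hs.of_norm_bounded fun p => hbound (b1 _) (b6 _ _)
  obtain ⟨s₂, hs₂⟩ : Summable fun p : ℤ × ℤ =>
      A p.1 * B p.2 * ((1 - v p.2 * x)⁻¹ * (1 - u p.1 / v p.2)⁻¹) :=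
    hs.of_norm_bounded fun p => hbound (b2 _) (b4 _ _)
  obtain ⟨s₃, hs₃⟩ : Summable fun p : ℤ × ℤ =>
      A p.1 * B p.2 * ((1 + v p.2 * x)⁻¹ * (1 + u p.1 / v p.2)⁻¹) :=
    hs.of_norm_bounded fun p => hbound (b3 _) (b5 _ _)
  have hterm (k l : ℤ) : A k * (1 - u k * x)⁻¹ * (B l * (1 - v l ^ 2 * x ^ 2)⁻¹) =
      A k * B l * ((1 - u k * x)⁻¹ * (1 - v l ^ 2 / u k ^ 2)⁻¹) +
      (A k * B l * ((1 - v l * x)⁻¹ * (1 - u k / v l)⁻¹) +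
        A k * B l * ((1 + v l * x)⁻¹ * (1 + u k / v l)⁻¹)) / 2 := by
    linear_combination A k * B l * three_pole_partial_fraction (hu0 k) (hv0 l) (h1 k) (h2 l) (h3 l)
      (h4 k l) (h5 k l)
  refine ⟨s₁, s₂, s₃, ?_, ?_, ?_, ?_⟩
  · have hp : HasSum (fun p : ℤ × ℤ => A p.1 * (1 - u p.1 * x)⁻¹ *
        (B p.2 * (1 - v p.2 ^ 2 * x ^ 2)⁻¹)) (s₁ + (s₂ + s₃) / 2) :=
      (hs₁.add ((hs₂.add hs₃).div_const 2)).of_eq (fun p => hterm _ _) rfl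
    exact (hF.mul hG hp.summable).unique hp
  · refine hs₁.prod_fiberwise fun k => ((hf k).mul_left (A k * (1 - u k * x)⁻¹)).of_eq
      (fun l => ?_) rfl
    ring
  · have h : HasSum (fun p : ℤ × ℤ =>
        A p.2 * B p.1 * ((1 - v p.1 * x)⁻¹ * (1 - u p.2 / v p.1)⁻¹)) s₂ :=
      (Equiv.prodComm ℤ ℤ).hasSum_iff.2 hs₂
    refine h.prod_fiberwise fun l => ((hg l).mul_left (B l * (1 - v l * x)⁻¹)).of_eq
      (fun k => ?_) rfl
    ring
  · have h : HasSum (fun p : ℤ × ℤ =>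
        A p.2 * B p.1 * ((1 + v p.1 * x)⁻¹ * (1 + u p.2 / v p.1)⁻¹)) s₃ :=
      (Equiv.prodComm ℤ ℤ).hasSum_iff.2 hs₃
    refine h.prod_fiberwise fun l => ((hg' l).mul_left (B l * (1 + v l * x)⁻¹)).of_eq
      (fun k => ?_) rfl
    ring

/-- Excludes poles: the points used below are powers of q times a constant of modulus one. -/
theorem eq_zero_of_mul_zpow_eq_one {c q : ℂ} (hq0 : q ≠ 0) (hq : ‖q‖ < 1) (hc : ‖c‖ = 1) {k : ℤ}
    (h : c * q ^ k = 1) : k = 0 := by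
  have h1 : ‖q‖ ^ k = ‖q‖ ^ (0 : ℤ) := by
    have := congrArg norm h
    simpa [hc] using this
  exact zpow_right_injective₀ (norm_pos_iff.2 hq0) hq.ne h1

theorem hasSum_int_even_add_odd {f : ℤ → ℂ} {a b : ℂ} (he : HasSum (fun m => f (2 * m)) a)
    (ho : HasSum (fun m => f (2 * m + 1)) b) : HasSum f (a + b) := by
  have h := mul_right_injective₀ (two_ne_zero' ℤ)
  replace he := h.hasSum_range_iff.2 he
  replace ho := ((add_left_injective (1 : ℤ)).comp h).hasSum_range_iff.2 ho
  refine he.add_isCompl ?_ ho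
  simpa [Function.comp_def] using Int.isCompl_even_odd

theorem zpow_pow_base (q : ℂ) (m : ℕ) (k : ℤ) : (q ^ m) ^ k = q ^ ((m : ℤ) * k) := by
  rw [zpow_mul, zpow_natCast]

theorem summable_norm_neg_one_zpow_tri_add {q : ℂ} (hq0 : q ≠ 0) (hq : ‖q‖ < 1) :
    Summable fun k : ℤ => ‖(-1) ^ k * q ^ (tri k + k)‖ := by
  have h := ((Equiv.addRight (1 : ℤ)).summable_iff.2
    (summable_zpow_tri (norm_pos_iff.2 hq0) hq)).mul_left ‖q‖⁻¹
  refine h.congr fun k => ?_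
  have := norm_ne_zero_iff.2 hq0
  simp only [Function.comp_apply, Equiv.coe_addRight, norm_mul, norm_zpow, norm_neg, norm_one,
    one_zpow, one_mul]
  rw [tri_add_one, ← add_assoc, zpow_add_one₀ this]
  field_simp

-- The nodes are u_k = q^(2k) and v_l = i q^(2l+1), with x = q. Then v_l² x² = -q⁴ q^(4l), and the
-- inner sums are reciprocal thetas to base q⁴ at the poles 1/u_k and to base q² at ±1/v_l.
open Complex in
theorem exists_watson_sums {q : ℂ} (hq0 : q ≠ 0) (hq : ‖q‖ < 1) :
    ∃ s₁ s₂ s₃ : ℂ, eulerFn (q ^ 2) ^ 2 * (q * theta (q ^ 2) q)⁻¹ *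
        (eulerFn (q ^ 4) ^ 2 * (theta (q ^ 4) (-q ^ 4))⁻¹) = s₁ + (s₂ + s₃) / 2 ∧
      HasSum (fun k : ℤ => (-1) ^ k * (q ^ 2) ^ (tri k + k) * (1 - q * (q ^ 2) ^ k)⁻¹ *
        (eulerFn (q ^ 4) ^ 2 * (theta (q ^ 4) (-q ^ 2 * (q ^ 4) ^ (-k)))⁻¹)) s₁ ∧
      HasSum (fun l : ℤ => (-1) ^ l * (q ^ 4) ^ tri l * (1 - I * q ^ 2 * (q ^ 2) ^ l)⁻¹ *
        (eulerFn (q ^ 2) ^ 2 * (-I * q⁻¹ * (q ^ 2) ^ (-l) *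
          theta (q ^ 2) (-I * q⁻¹ * (q ^ 2) ^ (-l)))⁻¹)) s₂ ∧
      HasSum (fun l : ℤ => (-1) ^ l * (q ^ 4) ^ tri l * (1 - -I * q ^ 2 * (q ^ 2) ^ l)⁻¹ *
        (eulerFn (q ^ 2) ^ 2 * (I * q⁻¹ * (q ^ 2) ^ (-l) *
          theta (q ^ 2) (I * q⁻¹ * (q ^ 2) ^ (-l)))⁻¹)) s₃ := by
  have hq2 := norm_pow_lt_one hq two_ne_zero
  have hq4 := norm_pow_lt_one hq four_ne_zero
  have h20 := pow_ne_zero 2 hq0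
  have h40 := pow_ne_zero 4 hq0
  have hz (k : ℤ) := zpow_ne_zero k hq0
  have hI := I_ne_zero
  have hI2 : I ^ 2 = -1 := I_sq
  have hne {c : ℂ} (hc : ‖c‖ = 1) {m : ℤ} (hm : m ≠ 0) : c * q ^ m ≠ 1 := fun h =>
    hm (eq_zero_of_mul_zpow_eq_one hq0 hq hc h)
  have hne' {c : ℂ} (hc : ‖c‖ = 1) (hc1 : c ≠ 1) (m : ℤ) : c * q ^ m ≠ 1 := fun h => by
    have h0 := eq_zero_of_mul_zpow_eq_one hq0 hq hc h
    rw [h0] at h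
    simp [hc1] at h
  have hI1 : ‖I‖ = 1 := norm_I
  have hnI1 : ‖-I‖ = 1 := by simp
  have hIne : I ≠ 1 := fun h => by simpa using congrArg Complex.re h
  have hnIne : -I ≠ 1 := fun h => by simpa using congrArg Complex.re h
  -- the nodes
  have x1 (k : ℤ) : q * (q ^ 2) ^ k ≠ 1 := by
    have := hne (c := 1) norm_one (m := 2 * k + 1) (by omega)
    rwa [one_mul, zpow_add_one₀ hq0, mul_comm, ← Nat.cast_ofNat (R := ℤ), ← zpow_pow_base] at this
  have x2 (k : ℤ) : I * q ^ 2 * (q ^ 2) ^ k ≠ 1 := by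
    have := hne' hI1 hIne (2 + 2 * k)
    rwa [zpow_add₀ hq0, ← mul_assoc, ← Nat.cast_ofNat (R := ℤ), ← zpow_pow_base,
      zpow_natCast] at this
  have x3 (k : ℤ) : -I * q ^ 2 * (q ^ 2) ^ k ≠ 1 := by
    have := hne' hnI1 hnIne (2 + 2 * k)
    rwa [zpow_add₀ hq0, ← mul_assoc, ← Nat.cast_ofNat (R := ℤ), ← zpow_pow_base,
      zpow_natCast] at this
  have x4 (k : ℤ) : -I * q⁻¹ * (q ^ 2) ^ k ≠ 1 := by
    have := hne' hnI1 hnIne (-1 + 2 * k)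
    rwa [zpow_add₀ hq0, zpow_neg_one, ← mul_assoc, ← Nat.cast_ofNat (R := ℤ),
      ← zpow_pow_base] at this
  have x5 (k : ℤ) : I * q⁻¹ * (q ^ 2) ^ k ≠ 1 := by
    have := hne' hI1 hIne (-1 + 2 * k)
    rwa [zpow_add₀ hq0, zpow_neg_one, ← mul_assoc, ← Nat.cast_ofNat (R := ℤ),
      ← zpow_pow_base] at this
  have x6 (k : ℤ) : -q ^ 2 * (q ^ 4) ^ k ≠ 1 := by
    have := hne' (c := -1) (by simp) (by norm_num) (2 + 4 * k)
    rwa [zpow_add₀ hq0, ← mul_assoc, ← Nat.cast_ofNat (R := ℤ), ← Nat.cast_ofNat (R := ℤ),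
      ← zpow_pow_base, zpow_natCast, neg_one_mul] at this
  have x7 (k : ℤ) : -q ^ 4 * (q ^ 4) ^ k ≠ 1 := by
    have := hne' (c := -1) (by simp) (by norm_num) (4 + 4 * k)
    rwa [zpow_add₀ hq0, ← mul_assoc, ← Nat.cast_ofNat (R := ℤ),
      ← zpow_pow_base, zpow_natCast, neg_one_mul] at this
  obtain ⟨M1, -, b1⟩ := exists_inv_one_sub_bound q h20 hq2
  obtain ⟨M2, -, b2⟩ := exists_inv_one_sub_bound (I * q ^ 2) h20 hq2
  obtain ⟨M3, -, b3⟩ := exists_inv_one_sub_bound (-I * q ^ 2) h20 hq2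
  obtain ⟨M4, -, b4⟩ := exists_inv_one_sub_bound (-I * q⁻¹) h20 hq2
  obtain ⟨M5, -, b5⟩ := exists_inv_one_sub_bound (I * q⁻¹) h20 hq2
  obtain ⟨M6, -, b6⟩ := exists_inv_one_sub_bound (-q ^ 2) h40 hq4
  set u : ℤ → ℂ := fun k => (q ^ 2) ^ k with hu
  set v : ℤ → ℂ := fun l => I * q * (q ^ 2) ^ l with hv
  have hu0 (k : ℤ) : u k ≠ 0 := zpow_ne_zero k h20
  have hv0 (k : ℤ) : v k ≠ 0 := mul_ne_zero (mul_ne_zero hI hq0) (zpow_ne_zero k h20)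
  have y1 (k : ℤ) : u k * q = q * (q ^ 2) ^ k := mul_comm _ _
  have y2 (l : ℤ) : 1 - v l * q = 1 - I * q ^ 2 * (q ^ 2) ^ l := by simp only [hv]; ring
  have y3 (l : ℤ) : 1 + v l * q = 1 - -I * q ^ 2 * (q ^ 2) ^ l := by simp only [hv]; ring
  have y4 (k l : ℤ) : 1 - u k / v l = 1 - -I * q⁻¹ * (q ^ 2) ^ (-l) * (q ^ 2) ^ k := by
    simp only [hu, hv]
    have := zpow_ne_zero l h20
    rw [zpow_neg]
    field_simp
    linear_combination (-(q ^ 2) ^ k) * hI2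
  have y5 (k l : ℤ) : 1 + u k / v l = 1 - I * q⁻¹ * (q ^ 2) ^ (-l) * (q ^ 2) ^ k := by
    simp only [hu, hv]
    have := zpow_ne_zero l h20
    rw [zpow_neg]
    field_simp
    linear_combination ((q ^ 2) ^ k) * hI2
  have y6 (k l : ℤ) : 1 - v l ^ 2 / u k ^ 2 = 1 - -q ^ 2 * (q ^ 4) ^ (-k) * (q ^ 4) ^ l := by
    simp only [hu, hv]
    have := zpow_ne_zero k h20
    rw [show q ^ 4 = q ^ 2 * q ^ 2 by ring, mul_zpow, mul_zpow, zpow_neg]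
    field_simp
    linear_combination (-q ^ 2 * ((q ^ 2) ^ l) ^ 2) * hI2
  have y7 (l : ℤ) : 1 - v l ^ 2 * q ^ 2 = 1 - -q ^ 4 * (q ^ 4) ^ l := by
    simp only [hv]
    rw [show q ^ 4 = q ^ 2 * q ^ 2 by ring, mul_zpow]
    linear_combination (-q ^ 4 * ((q ^ 2) ^ l) ^ 2) * hI2
  have z4 (l k : ℤ) : -I * q⁻¹ * (q ^ 2) ^ (-l) * (q ^ 2) ^ k =
      -I * q⁻¹ * (q ^ 2) ^ (k - l) := by rw [mul_assoc, ← zpow_add₀ h20, neg_add_eq_sub]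
  have z5 (l k : ℤ) : I * q⁻¹ * (q ^ 2) ^ (-l) * (q ^ 2) ^ k =
      I * q⁻¹ * (q ^ 2) ^ (k - l) := by rw [mul_assoc, ← zpow_add₀ h20, neg_add_eq_sub]
  have z6 (k l : ℤ) : -q ^ 2 * (q ^ 4) ^ (-k) * (q ^ 4) ^ l =
      -q ^ 2 * (q ^ 4) ^ (l - k) := by rw [mul_assoc, ← zpow_add₀ h40, neg_add_eq_sub]
  set M := max (max M1 (max M2 M3)) (max M4 (max M5 M6)) with hM
  have w0 : -I * q⁻¹ ≠ 0 := mul_ne_zero (neg_ne_zero.2 hI) (inv_ne_zero hq0)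
  have w1 : I * q⁻¹ ≠ 0 := mul_ne_zero hI (inv_ne_zero hq0)
  have key := exists_partial_fraction_mul (A := fun k => (-1) ^ k * (q ^ 2) ^ (tri k + k))
    (B := fun l => (-1) ^ l * (q ^ 4) ^ tri l) (u := u) (v := v) (x := q) (M := M)
    (summable_norm_neg_one_zpow_tri_add h20 hq2) (summable_norm_neg_one_zpow_tri h40 hq4) hu0 hv0
    (fun k => by rw [y1]; exact one_sub_mul_zpow_ne_zero x1 k)
    (fun l => by rw [y2]; exact one_sub_mul_zpow_ne_zero x2 l)
    (fun l => by rw [y3]; exact one_sub_mul_zpow_ne_zero x3 l)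
    (fun k l => by rw [y4, z4]; exact one_sub_mul_zpow_ne_zero x4 _)
    (fun k l => by rw [y5, z5]; exact one_sub_mul_zpow_ne_zero x5 _)
    (fun k => by rw [y1]; exact (b1 k).trans (by simp [hM]))
    (fun l => by rw [y2]; exact (b2 l).trans (by simp [hM]))
    (fun l => by rw [y3]; exact (b3 l).trans (by simp [hM]))
    (fun k l => by rw [y4, z4]; exact (b4 _).trans (by simp [hM]))
    (fun k l => by rw [y5, z5]; exact (b5 _).trans (by simp [hM]))
    (fun k l => by rw [y6, z6]; exact (b6 _).trans (by simp [hM]))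
    ((hasSum_inv_mul_theta h20 hq2 hq0 x1).of_eq (fun k => by rw [y1]) rfl)
    ((hasSum_inv_theta h40 hq4 (neg_ne_zero.2 h40) x7).of_eq (fun l => by rw [y7]) rfl)
    (fun k => (hasSum_inv_theta h40 hq4
      (mul_ne_zero (neg_ne_zero.2 h20) (zpow_ne_zero (-k) h40))
      (fun l => by rw [z6]; exact x6 _)).of_eq (fun l => by rw [y6]) rfl)
    (fun l => (hasSum_inv_mul_theta h20 hq2 (mul_ne_zero w0 (zpow_ne_zero (-l) h20))
      (fun k => by rw [z4]; exact x4 _)).of_eq (fun k => by rw [y4]) rfl)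
    (fun l => (hasSum_inv_mul_theta h20 hq2 (mul_ne_zero w1 (zpow_ne_zero (-l) h20))
      (fun k => by rw [z5]; exact x5 _)).of_eq (fun k => by rw [y5]) rfl)
  simpa only [y1, y2, y3] using key

theorem inv_theta_mul_zpow_neg {q x : ℂ} (hq0 : q ≠ 0) (hq : ‖q‖ < 1) (hx0 : x ≠ 0) (k : ℤ) :
    (theta q (x * q ^ (-k)))⁻¹ = q ^ tri k * (-x) ^ (-k) * (theta q x)⁻¹ := by
  have h := theta_mul_zpow_neg hq0 hq hx0 k
  have h1 := zpow_ne_zero (tri k) hq0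
  have h2 := zpow_ne_zero k (neg_ne_zero.2 hx0)
  rw [← eq_div_iff h1] at h
  rw [h, inv_div, zpow_neg, div_eq_mul_inv, mul_inv, mul_assoc]

theorem theta_neg_sq {q : ℂ} (hq0 : q ≠ 0) :
    theta (q ^ 4) (-q ^ 2) = qPochInf (-q ^ 2) (q ^ 4) ^ 2 := by
  rw [theta, show q ^ 4 / -q ^ 2 = -q ^ 2 by field_simp, pow_two (qPochInf _ _)]

theorem theta_neg_self {q : ℂ} (hq0 : q ≠ 0) (hq : ‖q‖ < 1) :
    theta q (-q) = 2 * qPochInf (-q) q ^ 2 := by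
  rw [theta, show q / -q = -1 by field_simp, qPochInf_shift (-1) hq, neg_one_mul]
  ring

theorem theta_sq_self {q : ℂ} (hq0 : q ≠ 0) : theta (q ^ 2) q = qPochInf q (q ^ 2) ^ 2 := by
  rw [theta, show q ^ 2 / q = q by field_simp, pow_two (qPochInf _ _)]

/-- As c² = -1, 1 - c/q = -(c/q)(1 + cq), and the remaining factors pair into (cq; q²)_∞ (-cq; q²)_∞
= (-q²; q⁴)_∞. -/
theorem theta_imaginary {q : ℂ} {c : ℂ} (hq0 : q ≠ 0) (hq : ‖q‖ < 1) (hc : c ^ 2 = -1) :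
    theta (q ^ 2) (c * q⁻¹) = -c * q⁻¹ * qPochInf (-q ^ 2) (q ^ 4) := by
  have hq2 := norm_pow_lt_one hq two_ne_zero
  have hc0 : c ≠ 0 := fun h => by simp [h] at hc
  have h1 := qPochInf_shift (c * q⁻¹) hq2
  have h2 := qPochInf_shift (-(c * q)) hq2
  have h3 := qPochInf_mul_neg (c * q) hq2
  rw [show c * q⁻¹ * q ^ 2 = c * q by field_simp] at h1
  rw [show (c * q) ^ 2 = -q ^ 2 by rw [mul_pow, hc]; ring, ← pow_mul] at h3
  rw [← h3, h2, theta, h1, show q ^ 2 / (c * q⁻¹) = -(c * q) * q ^ 2 by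
    field_simp
    linear_combination hc]
  generalize qPochInf (c * q) (q ^ 2) = X
  generalize qPochInf (-(c * q) * q ^ 2) (q ^ 2) = Y
  field_simp
  linear_combination (q * X * Y) * hc

theorem watson_term {q c : ℂ} (hq0 : q ≠ 0) (hq : ‖q‖ < 1) (hc : c ^ 2 = -1) (l : ℤ) :
    (-1) ^ l * (q ^ 4) ^ tri l * (1 - -c * q ^ 2 * (q ^ 2) ^ l)⁻¹ *
        (eulerFn (q ^ 2) ^ 2 * (c * q⁻¹ * (q ^ 2) ^ (-l) *
          theta (q ^ 2) (c * q⁻¹ * (q ^ 2) ^ (-l)))⁻¹) =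
      eulerFn (q ^ 2) ^ 2 * (qPochInf (-q ^ 2) (q ^ 4))⁻¹ *
        ((-c) ^ l * q ^ (3 * l ^ 2 + 6 * l + 2) * (1 + c * q ^ (2 * l + 2))⁻¹) := by
  have hc0 : c ≠ 0 := fun h => by simp [h] at hc
  have hci : c⁻¹ = -c := by
    refine inv_eq_of_mul_eq_one_right ?_
    linear_combination -hc
  have h20 := pow_ne_zero 2 hq0
  rw [mul_inv (c * q⁻¹ * _), inv_theta_mul_zpow_neg h20 (norm_pow_lt_one hq two_ne_zero)
    (mul_ne_zero hc0 (inv_ne_zero hq0)), theta_imaginary hq0 hq hc]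
  have e1 : 1 - -c * q ^ 2 * (q ^ 2) ^ l = 1 + c * q ^ (2 * l + 2) := by
    rw [zpow_add₀ hq0, zpow_pow_base, zpow_ofNat, Nat.cast_ofNat]
    ring
  have e2 : (-(c * q⁻¹)) ^ (-l) = c ^ l * q ^ l := by
    rw [← mul_zpow, zpow_neg, ← inv_zpow, inv_neg, mul_inv, hci, inv_inv]
    congr 1
    ring
  have e3 : (c * q⁻¹ * (q ^ 2) ^ (-l))⁻¹ = -c * q * q ^ (2 * l) := by
    rw [mul_inv, mul_inv, hci, inv_inv, zpow_neg, inv_inv, zpow_pow_base]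
    rfl
  have e4 : (-c * q⁻¹ * qPochInf (-q ^ 2) (q ^ 4))⁻¹ =
      c * q * (qPochInf (-q ^ 2) (q ^ 4))⁻¹ := by
    rw [mul_inv, mul_inv, inv_inv, inv_neg, hci, neg_neg]
  have e5 : 3 * l ^ 2 + 6 * l + 2 = 4 * tri l + 2 * tri l + 2 * l + l + 1 + 1 := by
    have := two_mul_tri l
    linarith
  rw [e1]
  generalize (1 + c * q ^ (2 * l + 2))⁻¹ = Y
  rw [e2, e3, e4, e5, zpow_pow_base, zpow_pow_base, zpow_add_one₀ hq0, zpow_add_one₀ hq0,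
    zpow_add₀ hq0 _ l, zpow_add₀ hq0 _ (2 * l), zpow_add₀ hq0 (4 * tri l), ← neg_one_mul c, mul_zpow]
  push_cast
  linear_combination (-(-1) ^ l * q ^ (4 * tri l) * Y *
    eulerFn (q ^ 2) ^ 2 * q ^ 2 * q ^ (2 * l) * q ^ (2 * tri l) * c ^ l * q ^ l *
    (qPochInf (-q ^ 2) (q ^ 4))⁻¹) * hc

theorem inv_one_add_imaginary_add {c y : ℂ} (hc : c ^ 2 = -1) (h1 : 1 + c * y ≠ 0)
    (h2 : 1 + -c * y ≠ 0) : (1 + c * y)⁻¹ + (1 + -c * y)⁻¹ = 2 * (1 + y ^ 2)⁻¹ := by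
  have h3 : (1 + c * y) * (1 + -c * y) = 1 + y ^ 2 := by linear_combination (-y ^ 2) * hc
  rw [← h3, inv_add_inv h1 h2, div_eq_mul_inv]
  ring

theorem inv_one_add_imaginary_sub {c y : ℂ} (hc : c ^ 2 = -1) (h1 : 1 + c * y ≠ 0)
    (h2 : 1 + -c * y ≠ 0) :
    c * (1 + c * y)⁻¹ - c * (1 + -c * y)⁻¹ = 2 * y * (1 + y ^ 2)⁻¹ := by
  have h3 : (1 + c * y) * (1 + -c * y) = 1 + y ^ 2 := by linear_combination (-y ^ 2) * hc
  rw [← h3, ← mul_sub, inv_sub_inv h1 h2, div_eq_mul_inv]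
  linear_combination (-2 * y * ((1 + c * y) * (1 + -c * y))⁻¹) * hc

-- Here s₁ is the Lambert series of g(q; q²). In s₂ + s₃ the conjugate fractions 1 / (1 ± iy) are
-- added for even l and subtracted for odd l, so the denominators become 1 + y²; the two parities
-- give g(-q⁴; q⁸) and 1 - g(-1; q⁸).
open Complex in
theorem watson_sum {q : ℂ} (hq0 : q ≠ 0) (hq : ‖q‖ < 1) :
    eulerFn (q ^ 2) ^ 2 * (q * theta (q ^ 2) q)⁻¹ *
        (eulerFn (q ^ 4) ^ 2 * (theta (q ^ 4) (-q ^ 4))⁻¹) =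
      eulerFn (q ^ 4) ^ 2 * (theta (q ^ 4) (-q ^ 2))⁻¹ * (eulerFn (q ^ 2) * mockG q (q ^ 2)) +
      eulerFn (q ^ 2) ^ 2 * (qPochInf (-q ^ 2) (q ^ 4))⁻¹ * eulerFn (q ^ 8) *
        (q⁻¹ * (1 - mockG (-1) (q ^ 8)) + q ^ 2 * mockG (-q ^ 4) (q ^ 8)) := by
  obtain ⟨s₁, s₂, s₃, h, h1, h2, h3⟩ := exists_watson_sums hq0 hq
  have hq2 := norm_pow_lt_one hq two_ne_zero
  have hq4 := norm_pow_lt_one hq four_ne_zero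
  have hq8 := norm_pow_lt_one hq (by norm_num : 8 ≠ 0)
  have h20 := pow_ne_zero 2 hq0
  have h40 := pow_ne_zero 4 hq0
  have h80 := pow_ne_zero 8 hq0
  have hI := I_ne_zero
  have hI2 : I ^ 2 = -1 := I_sq
  have e1 : s₁ = eulerFn (q ^ 4) ^ 2 * (theta (q ^ 4) (-q ^ 2))⁻¹ *
      (eulerFn (q ^ 2) * mockG q (q ^ 2)) := by
    refine h1.unique (((hasSum_mockG_lambert h20 hq2 hq0 fun k hk => ?_).mul_left
      (eulerFn (q ^ 4) ^ 2 * (theta (q ^ 4) (-q ^ 2))⁻¹)).of_eq (fun k => ?_) rfl)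
    · have := eq_zero_of_mul_zpow_eq_one (c := 1) (k := 2 * k + 1) hq0 hq norm_one (by
        rw [one_mul, zpow_add_one₀ hq0, mul_comm, ← hk, zpow_pow_base]
        rfl)
      omega
    · rw [inv_theta_mul_zpow_neg h40 hq4 (neg_ne_zero.2 h20), neg_neg,
        show (q ^ 4) ^ tri k = (q ^ 2) ^ (2 * tri k) by rw [zpow_pow_base, zpow_pow_base]; congr 1; push_cast; ring,
        show 3 * tri k = tri k + k + (2 * tri k + -k) by ring, zpow_add₀ h20 (tri k + k),
        zpow_add₀ h20 (2 * tri k)]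
      ring
  have e2 : s₂ + s₃ = 2 * (eulerFn (q ^ 2) ^ 2 * (qPochInf (-q ^ 2) (q ^ 4))⁻¹ * eulerFn (q ^ 8) *
        (q⁻¹ * (1 - mockG (-1) (q ^ 8)) + q ^ 2 * mockG (-q ^ 4) (q ^ 8))) := by
    have hz (k : ℤ) := zpow_ne_zero k hq0
    have hnz {c : ℂ} (hc : c ^ 2 = -1) (m : ℤ) : 1 + c * q ^ m ≠ 0 := fun h => by
      have hn : ‖-c‖ = 1 := by
        have := congrArg norm hc
        rw [norm_pow, norm_neg, norm_one] at this
        rw [norm_neg]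
        exact (pow_eq_one_iff_of_nonneg (norm_nonneg _) two_ne_zero).1 this
      have h' : -c * q ^ m = 1 := by linear_combination -h
      rw [eq_zero_of_mul_zpow_eq_one hq0 hq hn h', zpow_zero, mul_one] at h'
      rw [← neg_sq, h'] at hc
      norm_num at hc
    have hcI : (-I) ^ 2 = -1 := by rw [neg_sq, hI2]
    set K := eulerFn (q ^ 2) ^ 2 * (qPochInf (-q ^ 2) (q ^ 4))⁻¹ with hK
    have h4 : HasSum (fun l : ℤ => K * (I ^ l * q ^ (3 * l ^ 2 + 6 * l + 2) *
        (1 + -I * q ^ (2 * l + 2))⁻¹ + (-I) ^ l * q ^ (3 * l ^ 2 + 6 * l + 2) *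
        (1 + I * q ^ (2 * l + 2))⁻¹)) (s₂ + s₃) := by
      refine (h2.add h3).of_eq (fun l => ?_) rfl
      have t1 := watson_term hq0 hq hcI l
      rw [neg_neg] at t1
      rw [t1, watson_term hq0 hq hI2 l, mul_add]
    have hIe (m : ℤ) : I ^ (2 * m) = (-1) ^ m := by rw [zpow_mul, zpow_ofNat, hI2]
    have hIe' (m : ℤ) : (-I) ^ (2 * m) = (-1) ^ m := by rw [zpow_mul, zpow_ofNat, hcI]
    have he := (hasSum_mockG_lambert h80 hq8 (neg_ne_zero.2 h40) fun k hk => by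
      have := eq_zero_of_mul_zpow_eq_one (c := -1) (k := 4 + 8 * k) hq0 hq (by simp) (by
        refine Eq.trans ?_ hk
        rw [zpow_add₀ hq0, zpow_pow_base, zpow_ofNat, Nat.cast_ofNat]
        ring)
      omega).mul_left (K * (2 * q ^ 2))
    -- For l = 2m + 1 the exponent 2l + 2 is 4(m + 1), so the Lambert index is m + 1.
    have ho := ((Equiv.addRight (1 : ℤ)).hasSum_iff.2 (hasSum_one_add_mul_mockG h80 hq8
      (neg_ne_zero.2 one_ne_zero) fun k hk => by
        have h0 := eq_zero_of_mul_zpow_eq_one h80 hq8 (by simp) hk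
        rw [h0] at hk
        norm_num at hk)).mul_left (K * (2 * q⁻¹))
    refine h4.unique ((hasSum_int_even_add_odd (he.of_eq (fun m => ?_) rfl)
      (ho.of_eq (fun m => ?_) rfl)).of_eq (fun _ => rfl) ?_)
    · rw [hIe, hIe', zpow_pow_base, zpow_pow_base]
      have e1 : (3 * (2 * m) ^ 2 + 6 * (2 * m) + 2 : ℤ) = 8 * (3 * tri m) + 2 := by
        have := two_mul_tri m
        linarith
      have e2 : 1 - -q ^ 4 * q ^ (((8 : ℕ) : ℤ) * m) = 1 + (q ^ (2 * (2 * m) + 2)) ^ 2 := by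
        rw [← zpow_ofNat (q ^ _) 2, ← zpow_mul, show (2 * (2 * m) + 2) * 2 = 4 + 8 * m by ring,
          zpow_add₀ hq0, zpow_ofNat, Nat.cast_ofNat]
        ring
      have := inv_one_add_imaginary_add hI2 (hnz hI2 (2 * (2 * m) + 2)) (hnz hcI (2 * (2 * m) + 2))
      rw [e1, e2, zpow_add₀ hq0, zpow_ofNat, Nat.cast_ofNat]
      linear_combination (K * (-1) ^ m * q ^ (8 * (3 * tri m)) * q ^ 2) * this
    · simp only [Function.comp_apply, Equiv.coe_addRight]
      have hI3 : I ^ (2 * m + 1) = (-1) ^ m * I := by rw [zpow_add_one₀ hI, hIe]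
      have hI3' : (-I) ^ (2 * m + 1) = (-1) ^ m * -I := by
        rw [zpow_add_one₀ (neg_ne_zero.2 hI), hIe']
      have hm1 : (-1 : ℂ) ^ (m + 1) = -(-1) ^ m := by
        rw [zpow_add_one₀ (by norm_num)]
        ring
      have e1 : (3 * (2 * m + 1) ^ 2 + 6 * (2 * m + 1) + 2 : ℤ) =
          8 * (tri (m + 1) + (m + 1) ^ 2) + -(4 * (m + 1)) + -1 := by
        have := two_mul_tri (m + 1)
        linarith
      have e2 : 1 - -1 * (q ^ 8) ^ (m + 1) = 1 + (q ^ (4 * (m + 1))) ^ 2 := by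
        rw [← zpow_ofNat (q ^ _) 2, ← zpow_mul, zpow_pow_base,
          show 4 * (m + 1) * 2 = ((8 : ℕ) : ℤ) * (m + 1) by push_cast; ring]
        ring
      have := inv_one_add_imaginary_sub hI2 (hnz hI2 (4 * (m + 1))) (hnz hcI (4 * (m + 1)))
      rw [hI3, hI3', hm1, e2, e1, zpow_pow_base, zpow_add₀ hq0 _ (-1), zpow_add₀ hq0 _ (-(4 * (m + 1))),
        zpow_neg_one, zpow_neg, Nat.cast_ofNat, show 2 * (2 * m + 1) + 2 = 4 * (m + 1) by ring]
      have hY := hz (4 * (m + 1))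
      generalize q ^ (4 * (m + 1)) = Y at this hY ⊢
      generalize (1 + I * Y)⁻¹ = P at this ⊢
      generalize (1 + -I * Y)⁻¹ = P' at this ⊢
      generalize (1 + Y ^ 2)⁻¹ = R at this ⊢
      field_simp
      linear_combination (-K) * this
    · ring
  rw [h, e1, e2]
  ring

/-- Watson's relation, in terms of the universal mock theta function. -/
theorem watson_relation {q : ℂ} (hq0 : q ≠ 0) (hq : ‖q‖ < 1) :
    q * mockG q (q ^ 2) + (1 - mockG (-1) (q ^ 8)) + q ^ 3 * mockG (-q ^ 4) (q ^ 8) =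
      eulerFn (q ^ 2) * eulerFn (q ^ 4) ^ 6 / (2 * eulerFn q ^ 2 * eulerFn (q ^ 8) ^ 4) := by
  have hq2 := norm_pow_lt_one hq two_ne_zero
  have hq4 := norm_pow_lt_one hq four_ne_zero
  have h := watson_sum hq0 hq
  have E1 := eulerFn_ne_zero hq
  have E2 := eulerFn_ne_zero hq2
  have E4 := eulerFn_ne_zero hq4
  have E8 := eulerFn_ne_zero (norm_pow_lt_one hq (by norm_num : 8 ≠ 0))
  have r1 := qPochInf_odd_mul hq
  have r2 := qPochInf_neg_odd_mul hq2
  have r3 := qPochInf_neg_mul hq4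
  simp only [← pow_mul, Nat.reduceMul] at r2 r3
  rw [← eq_div_iff E2] at r1
  rw [← eq_div_iff (mul_ne_zero E2 E8)] at r2
  rw [← eq_div_iff E4] at r3
  rw [theta_neg_sq hq0, theta_neg_self (pow_ne_zero 4 hq0) hq4, theta_sq_self hq0, r1, r2, r3] at h
  field_simp at h ⊢
  linear_combination (-1) * h

/-! ### Theta functions and their dissections -/

theorem two_mul_tri_sub_one (k : ℤ) : 2 * tri (k - 1) = k ^ 2 - k := by
  rw [two_mul_tri]
  ring

theorem summable_norm_zpow_sq {q : ℂ} (hq0 : q ≠ 0) (hq : ‖q‖ < 1) :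
    Summable fun k : ℤ => ‖q ^ k ^ 2‖ := by
  refine Summable.of_nonneg_of_le (fun _ => norm_nonneg _) (fun k => ?_)
    (summable_zpow_tri (norm_pos_iff.2 hq0) hq)
  rw [norm_zpow]
  refine zpow_le_zpow_right_of_le_one₀ (norm_pos_iff.2 hq0) hq.le ?_
  have h1 := two_mul_tri k
  have h2 : k ≤ k ^ 2 := Int.le_self_sq k
  linarith

/-- This is φ(q): the triple product to base q² at z = -q, where both theta factors are (-q; q²)_∞.
-/
theorem hasSum_zpow_sq {q : ℂ} (hq0 : q ≠ 0) (hq : ‖q‖ < 1) :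
    HasSum (fun k : ℤ => q ^ k ^ 2)
      (eulerFn (q ^ 2) ^ 5 / (eulerFn q ^ 2 * eulerFn (q ^ 4) ^ 2)) := by
  have h20 := pow_ne_zero 2 hq0
  have hq2 := norm_pow_lt_one hq two_ne_zero
  have E1 := eulerFn_ne_zero hq
  have E4 := eulerFn_ne_zero (norm_pow_lt_one hq four_ne_zero)
  have e (k : ℤ) : (-1) ^ k * (-q) ^ k * (q ^ 2) ^ tri (k - 1) = q ^ k ^ 2 := by
    rw [← mul_zpow, neg_one_mul, neg_neg, zpow_pow_base, ← zpow_add₀ hq0, Nat.cast_ofNat,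
      two_mul_tri_sub_one]
    congr 1
    ring
  have h := hasSum_triple_product h20 hq2 (neg_ne_zero.2 hq0) (by
    simp only [e]
    exact summable_norm_zpow_sq hq0 hq)
  refine h.of_eq (fun k => (e k).symm) ?_
  have r := qPochInf_neg_odd_mul hq
  rw [← eq_div_iff (mul_ne_zero E1 E4)] at r
  rw [theta, show q ^ 2 / -q = -q by field_simp, r]
  field_simp

/-- The triple product at z = -q. The value is 2ψ(q), since k and -k - 1 give the same triangular
number. -/
theorem hasSum_zpow_tri {q : ℂ} (hq0 : q ≠ 0) (hq : ‖q‖ < 1) :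
    HasSum (fun k : ℤ => q ^ tri k) (2 * (eulerFn (q ^ 2) ^ 2 / eulerFn q)) := by
  have E1 := eulerFn_ne_zero hq
  have e (k : ℤ) : (-1) ^ k * (-q) ^ k * q ^ tri (k - 1) = q ^ tri k := by
    rw [← mul_zpow, neg_one_mul, neg_neg, ← zpow_add₀ hq0, tri_sub_one]
    congr 1
    ring
  have h := hasSum_triple_product hq0 hq (neg_ne_zero.2 hq0) (by
    simp only [e, norm_zpow]
    exact summable_zpow_tri (norm_pos_iff.2 hq0) hq)
  refine h.of_eq (fun k => (e k).symm) ?_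
  have r := qPochInf_neg_mul hq
  rw [← eq_div_iff E1] at r
  rw [theta_neg_self hq0 hq, r]
  field_simp

/-- The dissection `φ(q) = φ(q⁴) + 2 q ψ(q⁸)`. -/
theorem phi_dissection {q : ℂ} (hq0 : q ≠ 0) (hq : ‖q‖ < 1) :
    eulerFn (q ^ 2) ^ 5 / (eulerFn q ^ 2 * eulerFn (q ^ 4) ^ 2) =
      eulerFn (q ^ 8) ^ 5 / (eulerFn (q ^ 4) ^ 2 * eulerFn (q ^ 16) ^ 2) +
        2 * q * (eulerFn (q ^ 16) ^ 2 / eulerFn (q ^ 8)) := by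
  have h1 := hasSum_zpow_sq (pow_ne_zero 4 hq0) (norm_pow_lt_one hq four_ne_zero)
  have h2 := (hasSum_zpow_tri (pow_ne_zero 8 hq0)
    (norm_pow_lt_one hq (by norm_num : 8 ≠ 0))).mul_left q
  simp only [← pow_mul, Nat.reduceMul] at h1 h2
  refine ((hasSum_zpow_sq hq0 hq).unique (hasSum_int_even_add_odd (h1.of_eq (fun m => ?_) rfl)
    (h2.of_eq (fun m => ?_) rfl))).trans ?_
  · rw [zpow_pow_base]
    congr 1
    push_cast
    ring
  · rw [zpow_pow_base, show (2 * m + 1) ^ 2 = ((8 : ℕ) : ℤ) * tri m + 1 by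
      have := two_mul_tri m
      push_cast
      linarith, zpow_add_one₀ hq0, mul_comm]
  · ring

/-- Splits ℤ² by the parity of the coordinate sum. In the new coordinates m² + n² stays free of
cross terms, so φ(q)² separates into products again. -/
theorem hasSum_int_prod_of_parity {f : ℤ × ℤ → ℂ} {a b : ℂ}
    (he : HasSum (fun p : ℤ × ℤ => f (p.1 + p.2, p.1 - p.2)) a)
    (ho : HasSum (fun p : ℤ × ℤ => f (p.1 + p.2 + 1, p.1 - p.2)) b) : HasSum f (a + b) := by
  have i1 : Function.Injective fun p : ℤ × ℤ => (p.1 + p.2, p.1 - p.2) := by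
    rintro ⟨a, b⟩ ⟨c, d⟩ h
    simp only [Prod.mk.injEq] at h ⊢
    omega
  have i2 : Function.Injective fun p : ℤ × ℤ => (p.1 + p.2 + 1, p.1 - p.2) := by
    rintro ⟨a, b⟩ ⟨c, d⟩ h
    simp only [Prod.mk.injEq] at h ⊢
    omega
  refine HasSum.add_isCompl ?_ (i1.hasSum_range_iff.2 he) (i2.hasSum_range_iff.2 ho)
  refine IsCompl.of_le ?_ ?_
  · rintro _ ⟨⟨⟨a, b⟩, rfl⟩, ⟨⟨c, d⟩, h⟩⟩
    simp only [Prod.mk.injEq] at h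
    omega
  · rintro ⟨m, n⟩ -
    rcases Int.even_or_odd' (m + n) with ⟨c, hc | hc⟩
    · exact Or.inl ⟨(c, m - c), by simp only [Prod.mk.injEq]; omega⟩
    · exact Or.inr ⟨(c, m - c - 1), by simp only [Prod.mk.injEq]; omega⟩

theorem HasSum.mul_complex {ι κ : Type*} {f : ι → ℂ} {g : κ → ℂ} {s t : ℂ} (hf : HasSum f s)
    (hg : HasSum g t) : HasSum (fun p : ι × κ => f p.1 * g p.2) (s * t) :=
  hf.mul hg (summable_mul_of_summable_norm hf.summable.norm hg.summable.norm)

/-- The dissection `φ(q)² = φ(q²)² + 4 q ψ(q⁴)²`. -/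
theorem phi_sq_dissection {q : ℂ} (hq0 : q ≠ 0) (hq : ‖q‖ < 1) :
    (eulerFn (q ^ 2) ^ 5 / (eulerFn q ^ 2 * eulerFn (q ^ 4) ^ 2)) ^ 2 =
      (eulerFn (q ^ 4) ^ 5 / (eulerFn (q ^ 2) ^ 2 * eulerFn (q ^ 8) ^ 2)) ^ 2 +
        4 * q * (eulerFn (q ^ 8) ^ 2 / eulerFn (q ^ 4)) ^ 2 := by
  have h20 := pow_ne_zero 2 hq0
  have h40 := pow_ne_zero 4 hq0
  have hq2 := norm_pow_lt_one hq two_ne_zero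
  have hq4 := norm_pow_lt_one hq four_ne_zero
  have p0 := (hasSum_zpow_sq hq0 hq).mul_complex (hasSum_zpow_sq hq0 hq)
  have p1 := (hasSum_zpow_sq h20 hq2).mul_complex (hasSum_zpow_sq h20 hq2)
  have p2 := ((hasSum_zpow_tri h40 hq4).mul_complex (hasSum_zpow_tri h40 hq4)).mul_left q
  rw [← pow_mul, ← pow_mul] at p1
  rw [← pow_mul] at p2
  have e1 : HasSum (fun p : ℤ × ℤ => q ^ (p.1 + p.2) ^ 2 * q ^ (p.1 - p.2) ^ 2) _ := p1.of_eq
    (fun p => by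
      simp only [zpow_pow_base]
      rw [← zpow_add₀ hq0, ← zpow_add₀ hq0]
      congr 1
      push_cast
      ring) rfl
  have e2 : HasSum (fun p : ℤ × ℤ => q ^ (p.1 + p.2 + 1) ^ 2 * q ^ (p.1 - p.2) ^ 2) _ := p2.of_eq
    (fun p => by
      simp only [zpow_pow_base]
      rw [← zpow_add₀ hq0, ← zpow_add₀ hq0, mul_comm, ← zpow_add_one₀ hq0]
      congr 1
      have := two_mul_tri p.1
      have := two_mul_tri p.2
      push_cast
      linarith) rfl
  have key := p0.unique (hasSum_int_prod_of_parity
    (f := fun p : ℤ × ℤ => q ^ p.1 ^ 2 * q ^ p.2 ^ 2) e1 e2)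
  norm_num only at key
  linear_combination key

/-- Even and odd parts of a power series. -/
theorem hasSum_even_odd_parts {a : ℕ → ℂ} {f X Y : ℂ → ℂ}
    (hf : ∀ r : ℂ, r ≠ 0 → ‖r‖ < 1 → HasSum (fun n => a n * r ^ n) (f r))
    (hXY : ∀ r : ℂ, r ≠ 0 → ‖r‖ < 1 → f r = X (r ^ 2) + r * Y (r ^ 2))
    {q : ℂ} (hq0 : q ≠ 0) (hq : ‖q‖ < 1) :
    HasSum (fun n => a (2 * n) * q ^ n) (X q) ∧ HasSum (fun n => a (2 * n + 1) * q ^ n) (Y q) := by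
  -- With r a square root of q, f(r) + f(-r) and f(r) - f(-r) isolate X(q) and Y(q).
  obtain ⟨r, rfl⟩ : ∃ r : ℂ, q = r ^ 2 :=
    ⟨q ^ (1 / 2 : ℂ), by rw [← Complex.cpow_nat_mul]; norm_num⟩
  have hr0 : r ≠ 0 := fun h => hq0 (by simp [h])
  have hr : ‖r‖ < 1 := by
    rw [norm_pow] at hq
    exact (pow_lt_one_iff_of_nonneg (norm_nonneg _) two_ne_zero).1 hq
  have h1 := hf r hr0 hr
  have h2 := hf (-r) (neg_ne_zero.2 hr0) (by rwa [norm_neg])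
  rw [hXY r hr0 hr] at h1
  rw [hXY (-r) (neg_ne_zero.2 hr0) (by rwa [norm_neg]), neg_sq] at h2
  have i1 : Function.Injective fun n : ℕ => 2 * n := fun m n h => by simpa using h
  have i2 : Function.Injective fun n : ℕ => 2 * n + 1 := fun m n h => by simpa using h
  constructor
  · refine ((i1.hasSum_iff fun n hn => ?_).2 ((h1.add h2).div_const 2)).of_eq (fun n => ?_) ?_
    · have ho : Odd n := by
        rw [← Nat.not_even_iff_odd]
        exact fun ⟨m, hm⟩ => hn ⟨m, by simp only; omega⟩
      rw [ho.neg_pow]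
      ring
    · simp only [Function.comp_apply]
      rw [(even_two_mul n).neg_pow, pow_mul]
      ring
    · ring
  · refine ((i2.hasSum_iff fun n hn => ?_).2 ((h1.sub h2).div_const (2 * r))).of_eq
      (fun n => ?_) ?_
    · have ho : Even n := by
        rw [← Nat.not_odd_iff_even]
        exact fun ⟨m, hm⟩ => hn ⟨m, by simp only; omega⟩
      rw [ho.neg_pow, sub_self, zero_div]
    · simp only [Function.comp_apply]
      rw [(odd_two_mul_add_one n).neg_pow, pow_succ r (2 * n), pow_mul]
      field_simp
      ring
    · field_simp
      ring

/-! ### Generating function of odd Durfee symbols -/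

/-- Non-increasing lists of odd numbers below `2 N`. -/
def oddLists (N : ℕ) : Set (List ℕ) :=
  {l | l.Pairwise (fun x y => y ≤ x) ∧ (∀ x ∈ l, Odd x) ∧ ∀ x ∈ l, x < 2 * N}

theorem replicate_append_mem_oddLists {N : ℕ} (m : ℕ) {l : List ℕ} (hl : l ∈ oddLists N) :
    List.replicate m (2 * N + 1) ++ l ∈ oddLists (N + 1) := by
  obtain ⟨h1, h2, h3⟩ := hl
  refine ⟨List.pairwise_append.2 ⟨List.pairwise_replicate.2 (Or.inr le_rfl), h1, ?_⟩, ?_, ?_⟩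
  · intro a ha b hb
    rw [List.eq_of_mem_replicate ha]
    have := h3 b hb
    omega
  · intro x hx
    rcases List.mem_append.1 hx with h | h
    · rw [List.eq_of_mem_replicate h]
      exact odd_two_mul_add_one N
    · exact h2 x h
  · intro x hx
    rcases List.mem_append.1 hx with h | h
    · rw [List.eq_of_mem_replicate h]
      omega
    · have := h3 x h
      omega

theorem exists_replicate_append {N : ℕ} (L : List ℕ) (hL : L ∈ oddLists (N + 1)) :
    ∃ m, ∃ l ∈ oddLists N, List.replicate m (2 * N + 1) ++ l = L := by
  induction L with
  | nil => exact ⟨0, [], ⟨List.Pairwise.nil, by simp, by simp⟩, rfl⟩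
  | cons x L ih =>
    obtain ⟨h1, h2, h3⟩ := hL
    have hx := h3 x (by simp)
    rcases eq_or_ne x (2 * N + 1) with rfl | hne
    · obtain ⟨m, l, hl, rfl⟩ := ih ⟨(List.pairwise_cons.1 h1).2,
        fun y hy => h2 y (List.mem_cons_of_mem _ hy), fun y hy => h3 y (List.mem_cons_of_mem _ hy)⟩
      exact ⟨m + 1, l, hl, by simp [List.replicate_succ]⟩
    · refine ⟨0, x :: L, ⟨h1, h2, fun y hy => ?_⟩, rfl⟩
      obtain ⟨c, hc⟩ := h2 x (by simp)
      rcases List.mem_cons.1 hy with rfl | hy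
      · omega
      · have := (List.pairwise_cons.1 h1).1 y hy
        omega

/-- Splitting off the largest possible part. -/
noncomputable def oddListsSuccEquiv (N : ℕ) : ℕ × oddLists N ≃ oddLists (N + 1) :=
  Equiv.ofBijective (fun p => ⟨List.replicate p.1 (2 * N + 1) ++ p.2.1,
    replicate_append_mem_oddLists p.1 p.2.2⟩) (by
    constructor
    · rintro ⟨m, l, hl⟩ ⟨m', l', hl'⟩ h
      simp only [Subtype.mk.injEq] at h
      -- The multiplicity of 2N + 1 recovers m, as the smaller lists do not contain it.
      have hc := congrArg (List.count (2 * N + 1)) h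
      have z1 : List.count (2 * N + 1) l = 0 :=
        List.count_eq_zero.2 fun hm => by
          have := hl.2.2 _ hm
          omega
      have z2 : List.count (2 * N + 1) l' = 0 :=
        List.count_eq_zero.2 fun hm => by
          have := hl'.2.2 _ hm
          omega
      rw [List.count_append, List.count_append, z1, z2, List.count_replicate_self,
        List.count_replicate_self] at hc
      obtain rfl : m = m' := by simpa using hc
      obtain rfl := List.append_cancel_left h
      rfl
    · rintro ⟨L, hL⟩
      obtain ⟨m, l, hl, rfl⟩ := exists_replicate_append L hL
      exact ⟨(m, ⟨l, hl⟩), rfl⟩)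

/-- Each new admissible part 2N + 1 has free multiplicity and contributes a geometric series. -/
theorem hasSum_oddLists {q : ℂ} (hq : ‖q‖ < 1) (N : ℕ) :
    HasSum (fun l : oddLists N => q ^ l.1.sum) (qPoch q (q ^ 2) N)⁻¹ := by
  induction N with
  | zero =>
    refine (hasSum_single (⟨[], List.Pairwise.nil, by simp, by simp⟩ : oddLists 0)
      fun ⟨l, hl⟩ hne => ?_).of_eq (fun _ => rfl) (by simp [qPoch])
    refine absurd (Subtype.ext (List.eq_nil_iff_forall_not_mem.2 fun x hx => ?_)) hne
    have := hl.2.2 x hx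
    omega
  | succ N ih =>
    have hN := norm_pow_lt_one hq (by omega : 2 * N + 1 ≠ 0)
    have hg := hasSum_geometric_of_norm_lt_one hN
    have h := hg.mul_complex ih
    refine (oddListsSuccEquiv N).hasSum_iff.1 (h.of_eq (fun p => ?_) ?_)
    · change q ^ (List.replicate p.1 (2 * N + 1) ++ p.2.1).sum = _
      rw [List.sum_append, List.sum_replicate, smul_eq_mul, pow_add, mul_comm p.1, pow_mul]
    · rw [qPoch_succ, mul_inv, mul_comm, pow_succ' q (2 * N), pow_mul]

namespace OddDurfeeSymbol

/-- Symbols as pairs of lists over a subscript. -/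
def equivSigma : (Σ D : ℕ, oddLists (D + 1) × oddLists (D + 1)) ≃ OddDurfeeSymbol where
  toFun p := ⟨p.2.1.1, p.2.2.1, p.1, p.2.1.2.1, p.2.2.2.1, p.2.1.2.2.1, p.2.2.2.2.1,
    fun x hx => by have := p.2.1.2.2.2 x hx; omega, fun x hx => by have := p.2.2.2.2.2 x hx; omega⟩
  invFun S := ⟨S.D, ⟨S.top, S.top_sorted, S.top_odd, fun x hx => by have := S.top_le x hx; omega⟩,
    ⟨S.bottom, S.bottom_sorted, S.bottom_odd, fun x hx => by have := S.bottom_le x hx; omega⟩⟩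
  left_inv _ := rfl
  right_inv _ := rfl

theorem hasSum_fiber {q : ℂ} (hq : ‖q‖ < 1) (D : ℕ) :
    HasSum (fun p : oddLists (D + 1) × oddLists (D + 1) => q ^ (equivSigma ⟨D, p⟩).weight)
      (q * ((q ^ 2) ^ (D ^ 2 + D) * (finTheta (q ^ 2) q (D + 1) (D + 1))⁻¹)) := by
  have h := hasSum_oddLists hq (D + 1)
  refine ((h.mul_complex h).mul_left
    (q * (q ^ 2) ^ (D ^ 2 + D))).of_eq (fun p => ?_) ?_
  · change q ^ (p.1.1.sum + p.2.1.sum + 2 * D ^ 2 + 2 * D + 1) = _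
    ring
  · have : q ^ 2 / q = q := by
      rcases eq_or_ne q 0 with rfl | h0
      · simp
      · field_simp
    rw [finTheta, this, mul_inv]
    ring

theorem hasSum_weight {q : ℂ} (hq0 : q ≠ 0) (hq : ‖q‖ < 1) :
    HasSum (fun S : OddDurfeeSymbol => q ^ S.weight) (q * mockG q (q ^ 2)) := by
  have hD {q : ℂ} (hq0 : q ≠ 0) (hq : ‖q‖ < 1) :=
    (hasSum_mockG (pow_ne_zero 2 hq0) (norm_pow_lt_one hq two_ne_zero) hq0 fun k hk => by
      have := eq_zero_of_mul_zpow_eq_one (c := 1) (k := 2 * k + 1) hq0 hq norm_one (by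
        rw [one_mul, zpow_add_one₀ hq0, mul_comm, ← hk, zpow_pow_base]
        rfl)
      omega).mul_left q
  have hs : Summable fun p : Σ D : ℕ, oddLists (D + 1) × oddLists (D + 1) =>
      q ^ (equivSigma p).weight := by
    -- At the point ‖q‖ all terms are non-negative, so the iterated sums known there give absolute
    -- summability at q.
    set ρ : ℂ := (‖q‖ : ℂ) with hρ
    have hρ0 : ρ ≠ 0 := by simpa [hρ] using hq0
    have hρ1 : ‖ρ‖ < 1 := by simpa [hρ] using hq
    refine Summable.of_norm ?_
    simp only [norm_pow]
    refine (summable_sigma_of_nonneg fun _ => by positivity).2 ⟨fun D => ?_, ?_⟩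
    · rw [← Complex.summable_ofReal]
      exact (hasSum_fiber hρ1 D).summable.congr fun p => by push_cast; rfl
    · rw [← Complex.summable_ofReal]
      refine (hD hρ0 hρ1).summable.congr fun D => ?_
      rw [Complex.ofReal_tsum, ← (hasSum_fiber hρ1 D).tsum_eq]
      exact tsum_congr fun p => by push_cast; rfl
  obtain ⟨T, hT⟩ := hs
  rw [(hD hq0 hq).unique (hT.sigma fun D => hasSum_fiber hq D)]
  exact equivSigma.hasSum_iff.1 hT

theorem hasSum_ncard {q : ℂ} (hq0 : q ≠ 0) (hq : ‖q‖ < 1) :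
    HasSum (fun n : ℕ => ({S : OddDurfeeSymbol | S.weight = n}.ncard : ℂ) * q ^ n)
      (q * mockG q (q ^ 2)) := by
  refine ((Equiv.sigmaFiberEquiv weight).hasSum_iff.2 (hasSum_weight hq0 hq)).sigma fun n => ?_
  have : Finite {S : OddDurfeeSymbol // S.weight = n} := (finite_weight n).to_subtype
  have := Fintype.ofFinite {S : OddDurfeeSymbol // S.weight = n}
  refine (hasSum_fintype _).of_eq (fun _ => rfl) ?_
  rw [Finset.sum_congr rfl (g := fun _ => q ^ n) fun S _ => by
    change q ^ weight S.1 = q ^ n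
    rw [S.2]]
  rw [Finset.sum_const, nsmul_eq_mul, Finset.card_univ, ← Nat.card_eq_fintype_card]
  rfl

/-! ### Parity of the odd rank -/

theorem even_sum_iff {l : List ℕ} (h : ∀ x ∈ l, Odd x) : Even l.sum ↔ Even l.length := by
  induction l with
  | nil => simp
  | cons x l ih =>
    have hx : ¬ Even x := Nat.not_even_iff_odd.2 (h x (by simp))
    rw [List.sum_cons, List.length_cons, Nat.even_add, Nat.even_add_one,
      ih fun y hy => h y (List.mem_cons_of_mem _ hy)]
    tauto

theorem even_oddRank_iff (S : OddDurfeeSymbol) : Even S.oddRank ↔ Odd S.weight := by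
  have h1 := even_sum_iff S.top_odd
  have h2 := even_sum_iff S.bottom_odd
  have h3 : Even S.oddRank ↔ (Even S.top.length ↔ Even S.bottom.length) := by
    rw [oddRank, Int.even_sub, Int.even_coe_nat, Int.even_coe_nat]
  have h4 : Odd S.weight ↔ Even (S.top.sum + S.bottom.sum) := by
    rw [weight, ← Nat.not_even_iff_odd, Nat.even_add_one, not_not, Nat.even_add, Nat.even_add]
    simp
  rw [h3, h4, Nat.even_add, h1, h2]

end OddDurfeeSymbol

theorem oddRankCount_zero_two {n : ℕ} (hn : Odd n) :
    oddRankCount 0 2 n = {S : OddDurfeeSymbol | S.weight = n}.ncard := by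
  rw [oddRankCount]
  congr 1
  ext S
  simp only [Set.mem_ofPred_eq, and_iff_left_iff_imp]
  rintro rfl
  have := S.even_oddRank_iff.2 hn
  rw [Int.even_iff] at this
  exact this

theorem oddRankCount_one_two {n : ℕ} (hn : Even n) :
    oddRankCount 1 2 n = {S : OddDurfeeSymbol | S.weight = n}.ncard := by
  rw [oddRankCount]
  congr 1
  ext S
  simp only [Set.mem_ofPred_eq, and_iff_left_iff_imp]
  rintro rfl
  have := mt S.even_oddRank_iff.1 (Nat.not_odd_iff_even.2 hn)
  rw [Int.not_even_iff] at this
  exact this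

/-! ### The dissections -/

theorem eulerFn_pow_ne_zero {q : ℂ} (hq : ‖q‖ < 1) {m : ℕ} (hm : m ≠ 0) : eulerFn (q ^ m) ≠ 0 :=
  eulerFn_ne_zero (norm_pow_lt_one hq hm)

/-- Since φ(q) = J₂⁵ / (J₁² J₄²), the dissection of φ is one of 1 / J₁². -/
theorem inv_eulerFn_sq {q : ℂ} (hq0 : q ≠ 0) (hq : ‖q‖ < 1) :
    (eulerFn q ^ 2)⁻¹ = eulerFn (q ^ 4) ^ 2 / eulerFn (q ^ 2) ^ 5 *
      (eulerFn (q ^ 8) ^ 5 / (eulerFn (q ^ 4) ^ 2 * eulerFn (q ^ 16) ^ 2) +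
        2 * q * (eulerFn (q ^ 16) ^ 2 / eulerFn (q ^ 8))) := by
  have E2 := eulerFn_pow_ne_zero hq two_ne_zero
  have E4 := eulerFn_pow_ne_zero hq four_ne_zero
  rw [← phi_dissection hq0 hq]
  field_simp

theorem inv_eulerFn_pow_four {q : ℂ} (hq0 : q ≠ 0) (hq : ‖q‖ < 1) :
    (eulerFn q ^ 4)⁻¹ = eulerFn (q ^ 4) ^ 4 / eulerFn (q ^ 2) ^ 10 *
      ((eulerFn (q ^ 4) ^ 5 / (eulerFn (q ^ 2) ^ 2 * eulerFn (q ^ 8) ^ 2)) ^ 2 +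
        4 * q * (eulerFn (q ^ 8) ^ 2 / eulerFn (q ^ 4)) ^ 2) := by
  have E2 := eulerFn_pow_ne_zero hq two_ne_zero
  have E4 := eulerFn_pow_ne_zero hq four_ne_zero
  rw [← phi_sq_dissection hq0 hq]
  field_simp

/-- The dissection of `q ω(q)` into even and odd parts. -/
theorem mul_mockG_dissection {r : ℂ} (h0 : r ≠ 0) (h1 : ‖r‖ < 1) :
    r * mockG r (r ^ 2) = -1 + mockG (-1) (r ^ 8) + 1 / 2 * (eulerFn (r ^ 4) ^ 6 *
        eulerFn (r ^ 8) / (eulerFn (r ^ 2) ^ 4 * eulerFn (r ^ 16) ^ 2)) +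
      r * (-r ^ 2 * mockG (-r ^ 4) (r ^ 8) + eulerFn (r ^ 4) ^ 8 * eulerFn (r ^ 16) ^ 2 /
        (eulerFn (r ^ 2) ^ 4 * eulerFn (r ^ 8) ^ 5)) := by
  have E2 := eulerFn_pow_ne_zero h1 two_ne_zero
  have E4 := eulerFn_pow_ne_zero h1 four_ne_zero
  have E8 := eulerFn_pow_ne_zero h1 (by norm_num : 8 ≠ 0)
  have E16 := eulerFn_pow_ne_zero h1 (by norm_num : 16 ≠ 0)
  have h := watson_relation h0 h1
  have h3 : eulerFn (r ^ 2) * eulerFn (r ^ 4) ^ 6 / (2 * eulerFn r ^ 2 * eulerFn (r ^ 8) ^ 4) =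
      eulerFn (r ^ 2) * eulerFn (r ^ 4) ^ 6 / (2 * eulerFn (r ^ 8) ^ 4) * (eulerFn r ^ 2)⁻¹ := by
    rw [div_mul_eq_mul_div, div_eq_mul_inv, div_eq_mul_inv, mul_inv, mul_inv, mul_inv]
    ring
  rw [h3, inv_eulerFn_sq h0 h1] at h
  have h4 : eulerFn (r ^ 2) * eulerFn (r ^ 4) ^ 6 / (2 * eulerFn (r ^ 8) ^ 4) *
      (eulerFn (r ^ 4) ^ 2 / eulerFn (r ^ 2) ^ 5 *
      (eulerFn (r ^ 8) ^ 5 / (eulerFn (r ^ 4) ^ 2 * eulerFn (r ^ 16) ^ 2) +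
        2 * r * (eulerFn (r ^ 16) ^ 2 / eulerFn (r ^ 8)))) =
      1 / 2 * (eulerFn (r ^ 4) ^ 6 *
        eulerFn (r ^ 8) / (eulerFn (r ^ 2) ^ 4 * eulerFn (r ^ 16) ^ 2)) +
      r * (eulerFn (r ^ 4) ^ 8 * eulerFn (r ^ 16) ^ 2 /
        (eulerFn (r ^ 2) ^ 4 * eulerFn (r ^ 8) ^ 5)) := by
    field_simp
  linear_combination h + h4

theorem mainTheorem6 (q : ℂ) (hq0 : q ≠ 0) (hq1 : ‖q‖ < 1) :
    HasSum (fun n : ℕ => (oddRankCount 0 2 (2 * n + 1) : ℂ) * q ^ n)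
      (-q * mockG (-q ^ 2) (q ^ 4) + etaJ q 2 ^ 8 * etaJ q 8 ^ 2 / (etaJ q 1 ^ 4 * etaJ q 4 ^ 5)) ∧
    HasSum (fun n : ℕ => (oddRankCount 0 2 (4 * n + 1) : ℂ) * q ^ n)
      (etaJ q 2 ^ 9 / (etaJ q 1 ^ 6 * etaJ q 4 ^ 2)) ∧
    HasSum (fun n : ℕ => (oddRankCount 0 2 (4 * n + 3) : ℂ) * q ^ n)
      (-mockG (-q) (q ^ 2) + 4 * (etaJ q 4 ^ 6 / (etaJ q 1 ^ 2 * etaJ q 2 ^ 3))) ∧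
    HasSum (fun n : ℕ => (oddRankCount 1 2 (2 * n) : ℂ) * q ^ n)
      (-1 + mockG (-1) (q ^ 4) + 1 / 2 * (etaJ q 2 ^ 6 * etaJ q 4 / (etaJ q 1 ^ 4 *
          etaJ q 8 ^ 2))) ∧
    HasSum (fun n : ℕ => (oddRankCount 1 2 (4 * n) : ℂ) * q ^ n)
      (-1 + mockG (-1) (q ^ 2) + 1 / 2 * (etaJ q 2 ^ 15 / (etaJ q 1 ^ 8 * etaJ q 4 ^ 6))) ∧
    HasSum (fun n : ℕ => (oddRankCount 1 2 (4 * n + 2) : ℂ) * q ^ n)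
      (2 * (etaJ q 2 ^ 3 * etaJ q 4 ^ 2 / etaJ q 1 ^ 4)) ∧
    HasSum (fun n : ℕ => (oddRankCount 0 2 (8 * n + 1) : ℂ) * q ^ n)
      (etaJ q 2 ^ 12 * etaJ q 4 / (etaJ q 1 ^ 10 * etaJ q 8 ^ 2) +
        8 * q * (etaJ q 2 ^ 2 * etaJ q 4 ^ 3 * etaJ q 8 ^ 2 / etaJ q 1 ^ 6)) ∧
    HasSum (fun n : ℕ => (oddRankCount 0 2 (8 * n + 3) : ℂ) * q ^ n)
      (q * mockG (-q ^ 2) (q ^ 4) - etaJ q 2 ^ 8 * etaJ q 8 ^ 2 / (etaJ q 1 ^ 4 * etaJ q 4 ^ 5) +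
        4 * (etaJ q 2 ^ 6 * etaJ q 4 ^ 5 / (etaJ q 1 ^ 8 * etaJ q 8 ^ 2))) ∧
    HasSum (fun n : ℕ => (oddRankCount 0 2 (8 * n + 5) : ℂ) * q ^ n)
      (2 * (etaJ q 2 ^ 14 * etaJ q 8 ^ 2 / (etaJ q 1 ^ 10 * etaJ q 4 ^ 5) +
        2 * (etaJ q 4 ^ 9 / (etaJ q 1 ^ 6 * etaJ q 8 ^ 2)))) ∧
    HasSum (fun n : ℕ => (oddRankCount 0 2 (8 * n + 7) : ℂ) * q ^ n)
      (-q⁻¹ + q⁻¹ * mockG (-1) (q ^ 4) +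
        1 / 2 * q⁻¹ * (etaJ q 2 ^ 6 * etaJ q 4 / (etaJ q 1 ^ 4 * etaJ q 8 ^ 2)) +
        8 * (etaJ q 2 ^ 8 * etaJ q 8 ^ 2 / (etaJ q 1 ^ 8 * etaJ q 4))) ∧
    HasSum (fun n : ℕ => (oddRankCount 1 2 (8 * n) : ℂ) * q ^ n)
      (-1 + mockG (-1) q + 1 / 2 * (etaJ q 2 ^ 22 / (etaJ q 1 ^ 13 * etaJ q 4 ^ 8)) +
        8 * q * (etaJ q 4 ^ 8 / (etaJ q 1 ^ 5 * etaJ q 2 ^ 2))) ∧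
    HasSum (fun n : ℕ => (oddRankCount 1 2 (8 * n + 2) : ℂ) * q ^ n)
      (2 * (etaJ q 2 ^ 16 / (etaJ q 1 ^ 11 * etaJ q 4 ^ 4))) ∧
    HasSum (fun n : ℕ => (oddRankCount 1 2 (8 * n + 4) : ℂ) * q ^ n)
      (4 * (etaJ q 2 ^ 10 / etaJ q 1 ^ 9)) ∧
    HasSum (fun n : ℕ => (oddRankCount 1 2 (8 * n + 6) : ℂ) * q ^ n)
      (8 * (etaJ q 2 ^ 4 * etaJ q 4 ^ 4 / etaJ q 1 ^ 7)) := by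
  set a : ℕ → ℂ := fun n => ({S : OddDurfeeSymbol | S.weight = n}.ncard : ℂ) with ha
  have ev (n : ℕ) (hn : Even n) : (oddRankCount 1 2 n : ℂ) = a n := by
    rw [oddRankCount_one_two hn]
  have od (n : ℕ) (hn : Odd n) : (oddRankCount 0 2 n : ℂ) = a n := by
    rw [oddRankCount_zero_two hn]
  simp only [etaJ_eq, pow_one]
  -- `D0` splits modulo 2, `D1` and `D2` refine its odd and even parts modulo 4, and `D3` to `D6`
  -- refine these modulo 8. Mock terms depending on q², or q times such a term, pass whole into one
  -- part.
  have D0 {r : ℂ} (h0 : r ≠ 0) (h1 : ‖r‖ < 1) := hasSum_even_odd_parts (a := a)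
    (f := fun q => q * mockG q (q ^ 2))
    (X := fun q => -1 + mockG (-1) (q ^ 4) +
        1 / 2 * (eulerFn (q ^ 2) ^ 6 * eulerFn (q ^ 4) / (eulerFn q ^ 4 * eulerFn (q ^ 8) ^ 2)))
    (Y := fun q => -q * mockG (-q ^ 2) (q ^ 4) +
        eulerFn (q ^ 2) ^ 8 * eulerFn (q ^ 8) ^ 2 / (eulerFn q ^ 4 * eulerFn (q ^ 4) ^ 5))
    (fun r h0 h1 => OddDurfeeSymbol.hasSum_ncard h0 h1) (fun r h0 h1 => by
      simp only [← pow_mul, Nat.reduceMul]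
      exact mul_mockG_dissection h0 h1) h0 h1
  have D1 {r : ℂ} (h0 : r ≠ 0) (h1 : ‖r‖ < 1) :=
    hasSum_even_odd_parts (a := fun n => a (2 * n + 1))
    (f := fun q => -q * mockG (-q ^ 2) (q ^ 4) +
        eulerFn (q ^ 2) ^ 8 * eulerFn (q ^ 8) ^ 2 / (eulerFn q ^ 4 * eulerFn (q ^ 4) ^ 5))
    (X := fun q => eulerFn (q ^ 2) ^ 9 / (eulerFn q ^ 6 * eulerFn (q ^ 4) ^ 2))
    (Y := fun q => -mockG (-q) (q ^ 2) + 4 * (eulerFn (q ^ 4) ^ 6 / (eulerFn q ^ 2 *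
        eulerFn (q ^ 2) ^ 3)))
    (fun r h0 h1 => (D0 h0 h1).2) (fun r h0 h1 => by
      have E1 := eulerFn_ne_zero h1
      have E2 := eulerFn_pow_ne_zero h1 two_ne_zero
      have E4 := eulerFn_pow_ne_zero h1 four_ne_zero
      have E8 := eulerFn_pow_ne_zero h1 (by norm_num : 8 ≠ 0)
      have E16 := eulerFn_pow_ne_zero h1 (by norm_num : 16 ≠ 0)
      have i4 := inv_eulerFn_pow_four h0 h1
      simp only [← pow_mul, Nat.reduceMul]
      have h : eulerFn (r ^ 2) ^ 8 * eulerFn (r ^ 8) ^ 2 / (eulerFn r ^ 4 * eulerFn (r ^ 4) ^ 5) =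
          eulerFn (r ^ 2) ^ 8 * eulerFn (r ^ 8) ^ 2 / eulerFn (r ^ 4) ^ 5 *
              (eulerFn r ^ 4)⁻¹ := by field_simp
      rw [h, i4]
      field_simp
      ring) h0 h1
  have D2 {r : ℂ} (h0 : r ≠ 0) (h1 : ‖r‖ < 1) :=
    hasSum_even_odd_parts (a := fun n => a (2 * n))
    (f := fun q => -1 + mockG (-1) (q ^ 4) +
        1 / 2 * (eulerFn (q ^ 2) ^ 6 * eulerFn (q ^ 4) / (eulerFn q ^ 4 * eulerFn (q ^ 8) ^ 2)))
    (X := fun q => -1 + mockG (-1) (q ^ 2) +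
        1 / 2 * (eulerFn (q ^ 2) ^ 15 / (eulerFn q ^ 8 * eulerFn (q ^ 4) ^ 6)))
    (Y := fun q => 2 * (eulerFn (q ^ 2) ^ 3 * eulerFn (q ^ 4) ^ 2 / eulerFn q ^ 4))
    (fun r h0 h1 => (D0 h0 h1).1) (fun r h0 h1 => by
      have E1 := eulerFn_ne_zero h1
      have E2 := eulerFn_pow_ne_zero h1 two_ne_zero
      have E4 := eulerFn_pow_ne_zero h1 four_ne_zero
      have E8 := eulerFn_pow_ne_zero h1 (by norm_num : 8 ≠ 0)
      have E16 := eulerFn_pow_ne_zero h1 (by norm_num : 16 ≠ 0)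
      have i4 := inv_eulerFn_pow_four h0 h1
      simp only [← pow_mul, Nat.reduceMul]
      have h : eulerFn (r ^ 2) ^ 6 * eulerFn (r ^ 4) / (eulerFn r ^ 4 * eulerFn (r ^ 8) ^ 2) =
          eulerFn (r ^ 2) ^ 6 * eulerFn (r ^ 4) / eulerFn (r ^ 8) ^ 2 *
              (eulerFn r ^ 4)⁻¹ := by field_simp
      rw [h, i4]
      field_simp
      ring) h0 h1
  have D3 {r : ℂ} (h0 : r ≠ 0) (h1 : ‖r‖ < 1) :=
    hasSum_even_odd_parts (a := fun n => a (2 * (2 * n) + 1))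
    (f := fun q => eulerFn (q ^ 2) ^ 9 / (eulerFn q ^ 6 * eulerFn (q ^ 4) ^ 2))
    (X := fun q => eulerFn (q ^ 2) ^ 12 * eulerFn (q ^ 4) / (eulerFn q ^ 10 *
        eulerFn (q ^ 8) ^ 2) + 8 * q * (eulerFn (q ^ 2) ^ 2 * eulerFn (q ^ 4) ^ 3 *
        eulerFn (q ^ 8) ^ 2 / eulerFn q ^ 6))
    (Y := fun q => 2 * (eulerFn (q ^ 2) ^ 14 * eulerFn (q ^ 8) ^ 2 / (eulerFn q ^ 10 *
        eulerFn (q ^ 4) ^ 5) + 2 * (eulerFn (q ^ 4) ^ 9 / (eulerFn q ^ 6 * eulerFn (q ^ 8) ^ 2))))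
    (fun r h0 h1 => (D1 h0 h1).1) (fun r h0 h1 => by
      have E1 := eulerFn_ne_zero h1
      have E2 := eulerFn_pow_ne_zero h1 two_ne_zero
      have E4 := eulerFn_pow_ne_zero h1 four_ne_zero
      have E8 := eulerFn_pow_ne_zero h1 (by norm_num : 8 ≠ 0)
      have E16 := eulerFn_pow_ne_zero h1 (by norm_num : 16 ≠ 0)
      have i2 := inv_eulerFn_sq h0 h1
      have i4 := inv_eulerFn_pow_four h0 h1
      simp only [← pow_mul, Nat.reduceMul]
      -- Here 1 / J₁⁶ is the product of the two dissected series 1 / J₁² and 1 / J₁⁴.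
      have h : eulerFn (r ^ 2) ^ 9 / (eulerFn r ^ 6 * eulerFn (r ^ 4) ^ 2) =
          eulerFn (r ^ 2) ^ 9 / eulerFn (r ^ 4) ^ 2 * ((eulerFn r ^ 2)⁻¹ *
              (eulerFn r ^ 4)⁻¹) := by field_simp
      rw [h, i2, i4]
      field_simp
      ring) h0 h1
  have D4 {r : ℂ} (h0 : r ≠ 0) (h1 : ‖r‖ < 1) :=
    hasSum_even_odd_parts (a := fun n => a (2 * (2 * n + 1) + 1))
    (f := fun q => -mockG (-q) (q ^ 2) + 4 * (eulerFn (q ^ 4) ^ 6 / (eulerFn q ^ 2 *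
        eulerFn (q ^ 2) ^ 3)))
    (X := fun q => q * mockG (-q ^ 2) (q ^ 4) - eulerFn (q ^ 2) ^ 8 * eulerFn (q ^ 8) ^ 2 /
        (eulerFn q ^ 4 * eulerFn (q ^ 4) ^ 5) +
        4 * (eulerFn (q ^ 2) ^ 6 * eulerFn (q ^ 4) ^ 5 / (eulerFn q ^ 8 * eulerFn (q ^ 8) ^ 2)))
    (Y := fun q => -q⁻¹ + q⁻¹ * mockG (-1) (q ^ 4) +
        1 / 2 * q⁻¹ * (eulerFn (q ^ 2) ^ 6 * eulerFn (q ^ 4) / (eulerFn q ^ 4 *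
        eulerFn (q ^ 8) ^ 2)) + 8 * (eulerFn (q ^ 2) ^ 8 * eulerFn (q ^ 8) ^ 2 / (eulerFn q ^ 8 *
        eulerFn (q ^ 4))))
    (fun r h0 h1 => (D1 h0 h1).2) (fun r h0 h1 => by
      have E1 := eulerFn_ne_zero h1
      have E2 := eulerFn_pow_ne_zero h1 two_ne_zero
      have E4 := eulerFn_pow_ne_zero h1 four_ne_zero
      have E8 := eulerFn_pow_ne_zero h1 (by norm_num : 8 ≠ 0)
      have E16 := eulerFn_pow_ne_zero h1 (by norm_num : 16 ≠ 0)
      have i2 := inv_eulerFn_sq h0 h1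
      simp only [← pow_mul, Nat.reduceMul]
      -- The term g(-r; r²) is split by the first dissection taken at -r. Dividing by r exchanges
      -- the parities, which is how q⁻¹ enters `Y`.
      have hm := mul_mockG_dissection (neg_ne_zero.2 h0) (by rwa [norm_neg])
      simp only [even_two.neg_pow, (by decide : Even 4).neg_pow, (by decide : Even 8).neg_pow,
        (by decide : Even 16).neg_pow] at hm
      have hm' : -mockG (-r) (r ^ 2) = r⁻¹ * (-r * mockG (-r) (r ^ 2)) := by field_simp
      rw [hm] at hm'
      have h : eulerFn (r ^ 4) ^ 6 / (eulerFn r ^ 2 * eulerFn (r ^ 2) ^ 3) =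
          eulerFn (r ^ 4) ^ 6 / eulerFn (r ^ 2) ^ 3 * (eulerFn r ^ 2)⁻¹ := by field_simp
      rw [hm', h, i2]
      field_simp
      ring) h0 h1
  have D5 {r : ℂ} (h0 : r ≠ 0) (h1 : ‖r‖ < 1) :=
    hasSum_even_odd_parts (a := fun n => a (2 * (2 * n)))
    (f := fun q => -1 + mockG (-1) (q ^ 2) +
        1 / 2 * (eulerFn (q ^ 2) ^ 15 / (eulerFn q ^ 8 * eulerFn (q ^ 4) ^ 6)))
    (X := fun q => -1 + mockG (-1) q + 1 / 2 * (eulerFn (q ^ 2) ^ 22 / (eulerFn q ^ 13 *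
        eulerFn (q ^ 4) ^ 8)) + 8 * q * (eulerFn (q ^ 4) ^ 8 / (eulerFn q ^ 5 *
        eulerFn (q ^ 2) ^ 2)))
    (Y := fun q => 4 * (eulerFn (q ^ 2) ^ 10 / eulerFn q ^ 9))
    (fun r h0 h1 => (D2 h0 h1).1) (fun r h0 h1 => by
      have E1 := eulerFn_ne_zero h1
      have E2 := eulerFn_pow_ne_zero h1 two_ne_zero
      have E4 := eulerFn_pow_ne_zero h1 four_ne_zero
      have E8 := eulerFn_pow_ne_zero h1 (by norm_num : 8 ≠ 0)
      have E16 := eulerFn_pow_ne_zero h1 (by norm_num : 16 ≠ 0)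
      have i4 := inv_eulerFn_pow_four h0 h1
      simp only [← pow_mul, Nat.reduceMul]
      have h : eulerFn (r ^ 2) ^ 15 / (eulerFn r ^ 8 * eulerFn (r ^ 4) ^ 6) =
          eulerFn (r ^ 2) ^ 15 / eulerFn (r ^ 4) ^ 6 * ((eulerFn r ^ 4)⁻¹ *
              (eulerFn r ^ 4)⁻¹) := by field_simp
      rw [h, i4]
      field_simp
      ring) h0 h1
  have D6 {r : ℂ} (h0 : r ≠ 0) (h1 : ‖r‖ < 1) :=
    hasSum_even_odd_parts (a := fun n => a (2 * (2 * n + 1)))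
    (f := fun q => 2 * (eulerFn (q ^ 2) ^ 3 * eulerFn (q ^ 4) ^ 2 / eulerFn q ^ 4))
    (X := fun q => 2 * (eulerFn (q ^ 2) ^ 16 / (eulerFn q ^ 11 * eulerFn (q ^ 4) ^ 4)))
    (Y := fun q => 8 * (eulerFn (q ^ 2) ^ 4 * eulerFn (q ^ 4) ^ 4 / eulerFn q ^ 7))
    (fun r h0 h1 => (D2 h0 h1).2) (fun r h0 h1 => by
      have E1 := eulerFn_ne_zero h1
      have E2 := eulerFn_pow_ne_zero h1 two_ne_zero
      have E4 := eulerFn_pow_ne_zero h1 four_ne_zero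
      have E8 := eulerFn_pow_ne_zero h1 (by norm_num : 8 ≠ 0)
      have E16 := eulerFn_pow_ne_zero h1 (by norm_num : 16 ≠ 0)
      have i4 := inv_eulerFn_pow_four h0 h1
      simp only [← pow_mul, Nat.reduceMul]
      have h : eulerFn (r ^ 2) ^ 3 * eulerFn (r ^ 4) ^ 2 / eulerFn r ^ 4 =
          eulerFn (r ^ 2) ^ 3 * eulerFn (r ^ 4) ^ 2 * (eulerFn r ^ 4)⁻¹ := by field_simp
      rw [h, i4]
      field_simp
      ring) h0 h1
  refine ⟨?_, ?_, ?_, ?_, ?_, ?_, ?_, ?_, ?_, ?_, ?_, ?_, ?_, ?_⟩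
  · refine (D0 hq0 hq1).2.of_eq (fun n => ?_) rfl
    rw [od _ (by rw [Nat.odd_iff]; omega)]
  · refine (D1 hq0 hq1).1.of_eq (fun n => ?_) rfl
    rw [od _ (by rw [Nat.odd_iff]; omega)]
    congr 2
    omega
  · refine (D1 hq0 hq1).2.of_eq (fun n => ?_) rfl
    rw [od _ (by rw [Nat.odd_iff]; omega)]
    congr 2
    omega
  · refine (D0 hq0 hq1).1.of_eq (fun n => ?_) rfl
    rw [ev _ (by rw [Nat.even_iff]; omega)]
  · refine (D2 hq0 hq1).1.of_eq (fun n => ?_) rfl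
    rw [ev _ (by rw [Nat.even_iff]; omega)]
    congr 2
    omega
  · refine (D2 hq0 hq1).2.of_eq (fun n => ?_) rfl
    rw [ev _ (by rw [Nat.even_iff]; omega)]
    congr 2
    omega
  · refine (D3 hq0 hq1).1.of_eq (fun n => ?_) rfl
    rw [od _ (by rw [Nat.odd_iff]; omega)]
    congr 2
    omega
  · refine (D4 hq0 hq1).1.of_eq (fun n => ?_) rfl
    rw [od _ (by rw [Nat.odd_iff]; omega)]
    congr 2
    omega
  · refine (D3 hq0 hq1).2.of_eq (fun n => ?_) rfl
    rw [od _ (by rw [Nat.odd_iff]; omega)]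
    congr 2
    omega
  · refine (D4 hq0 hq1).2.of_eq (fun n => ?_) rfl
    rw [od _ (by rw [Nat.odd_iff]; omega)]
    congr 2
    omega
  · refine (D5 hq0 hq1).1.of_eq (fun n => ?_) rfl
    rw [ev _ (by rw [Nat.even_iff]; omega)]
    congr 2
    omega
  · refine (D6 hq0 hq1).1.of_eq (fun n => ?_) rfl
    rw [ev _ (by rw [Nat.even_iff]; omega)]
    congr 2
    omega
  · refine (D5 hq0 hq1).2.of_eq (fun n => ?_) rfl
    rw [ev _ (by rw [Nat.even_iff]; omega)]
    congr 2
    omega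
  · refine (D6 hq0 hq1).2.of_eq (fun n => ?_) rfl
    rw [ev _ (by rw [Nat.even_iff]; omega)]
    congr 2
    omega
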